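/- Let $\mathbb K$ be $\mathbb R$ or $\mathbb C$, let $(X_n)_{n\in\mathbb N}$ be a sequence of Banach spaces over $\mathbb K$, let $X=\left(\sum_{n} X_n\right)_2$ be their $\ell_2$-sum, and let $P_n$ be the canonical projection of $X$ onto $X_n$ (regarded as a subspace of $X$). For a bounded operator $T:E\to F$ between Banach spaces let - $\pi_1(T)\in[0,\infty]$ be the 1-summing norm, the infimum of all $C\ge 0$ such that $\sum_i\|Tx_i\|\le C\sup_{\|x^*\|\le 1}\sum_i|x^*(x_i)|$ for all finite families $(x_i)$ in $E$; - $\gamma_1(T)=\inf\|A\|\,\|B\|$, over all measures $\nu$ and all factorizations $T=BA$ with $A\in B(E,L_1(\nu))$, $B\in B(L_1(\nu),F)$. For $T:\ell_2\to E$ let $\ell(T)=\bigl(\int\|\sum_{j}g_jTe_j\|^2\,d\mu\bigr)^{1/2}$, where $(g_j)$ is a sequence of independent (real) standard Gaussian variables on a probability space with measure $\mu$, $(e_j)$ is the unit vector basis of $\ell_2$, and the series converges in $L_2(\mu,E)$, as it does whenever $T$ has finite rank. A Banach space $E$ - has $\mathit{GAP}$ with constant $C$ if $\ell(T)\le C\,\pi_1(T^*)$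 for every bounded finite rank operator $T:\ell_2\to E$; - has $\mathit{GL}_2$ with constant $C$ if $\gamma_1(T)\le C\,\pi_1(T)$ for every bounded finite rank operator $T:E\to\ell_2$; - is of cotype 2 with constant $C$ if $\bigl(\sum_{i=1}^m\|x_i\|^2\bigr)^{1/2}\le C\bigl(2^{-m}\sum_{\varepsilon\in\{-1,1\}^m}\|\sum_{i=1}^m\varepsilon_ix_i\|^2\bigr)^{1/2}$ for all $m$ and all $x_1,\dots,x_m\in E$. Suppose that there is a constant $C$ such that one of the following holds: (i) $X_n^*$ has $\mathit{GAP}$ with constant $C$ for every $n$; (ii) $X_n$ has $\mathit{GL}_2$ with constant $C$ for every $n$; (iii) $X_n$ is of cotype 2 with constant $C$ for every $n$. Then there is a constant $K<\infty$ such that $$\pi_1(T)\le K\Bigl(\sum_{n}\pi_1(TP_n)^2\Bigr)^{1/2}$$ for every bounded finite rank operator $T:X\to\ell_2$. -/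

import Mathlib

open MeasureTheory ProbabilityTheory Filter Topology
open scoped ENNReal NNReal

universe u

noncomputable section

namespace GaussianAverage

/-- The Hilbert space of square summable scalar sequences. -/
abbrev Ell2 (𝕜 : Type*) [RCLike 𝕜] : Type _ := lp (fun _ : ℕ => 𝕜) 2

/-- The unit vector basis of `Ell2`. -/
def unitVec (𝕜 : Type*) [RCLike 𝕜] (n : ℕ) : Ell2 𝕜 := lp.single 2 n (1 : 𝕜)

section Operators

variable {𝕜 : Type*} [RCLike 𝕜]
variable {E : Type*} [NormedAddCommGroup E] [NormedSpace 𝕜 E]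
variable {F : Type*} [NormedAddCommGroup F] [NormedSpace 𝕜 F]

/-- Bounded operators of finite rank. -/
def IsFiniteRank (T : E →L[𝕜] F) : Prop :=
  FiniteDimensional 𝕜 (LinearMap.range (T : E →ₗ[𝕜] F))

/-- The (Banach space) adjoint, `y* ↦ y* ∘ T`. -/
def dualOp (T : E →L[𝕜] F) : StrongDual 𝕜 F →L[𝕜] StrongDual 𝕜 E :=
  (ContinuousLinearMap.compL 𝕜 E F 𝕜).flip T

/-- The weak `ℓ₁`-norm of a finite family: the supremum of `∑ |x*(xᵢ)|` over the unit ball of the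
dual space. -/
def weakL1Norm (𝕜 : Type*) [RCLike 𝕜] {E : Type*} [NormedAddCommGroup E] [NormedSpace 𝕜 E]
    {n : ℕ} (x : Fin n → E) : ℝ≥0∞ :=
  ⨆ (f : StrongDual 𝕜 E) (_ : ‖f‖ ≤ 1), ∑ i, ‖f (x i)‖ₑ

/-- The 1-summing norm `π₁(T)`, with the value `∞` when `T` is not 1-summing. -/
def pi1 (T : E →L[𝕜] F) : ℝ≥0∞ :=
  ⨅ (C : ℝ≥0) (_ : ∀ (n : ℕ) (x : Fin n → E), ∑ i, ‖T (x i)‖ₑ ≤ C * weakL1Norm 𝕜 x), (C : ℝ≥0∞)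

end Operators

/-- The norm `γ₁(T)` of factorization through `L₁(ν)` spaces, `ν` an arbitrary measure, with the
value `∞` when there is no factorization. -/
def gamma1 {𝕜 : Type*} [RCLike 𝕜] {E : Type u} [NormedAddCommGroup E] [NormedSpace 𝕜 E]
    {F : Type*} [NormedAddCommGroup F] [NormedSpace 𝕜 F] (T : E →L[𝕜] F) : ℝ≥0∞ :=
  ⨅ (Ω : Type u) (_ : MeasurableSpace Ω) (ν : Measure Ω)
    (A : E →L[𝕜] Lp 𝕜 1 ν) (B : Lp 𝕜 1 ν →L[𝕜] F) (_ : T = B.comp A), ‖A‖ₑ * ‖B‖ₑ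

/-- The probability space carrying the sequence `(gₙ)` of independent standard Gaussian variables:
`ℝ^ℕ` with the product of the standard normal laws; `gₙ` is the `n`-th coordinate. -/
def gaussSeq : Measure (ℕ → ℝ) := Measure.infinitePi (fun _ : ℕ => gaussianReal 0 1)

section Properties

variable {𝕜 : Type*} [RCLike 𝕜]

/-- The partial sums `∑_{j < n} gⱼ T eⱼ`. -/
def gaussPartialSum {E : Type*} [NormedAddCommGroup E] [NormedSpace 𝕜 E] (T : Ell2 𝕜 →L[𝕜] E) (n : ℕ)
    (ω : ℕ → ℝ) : E :=
  ∑ j ∈ Finset.range n, (ω j : 𝕜) • T (unitVec 𝕜 j)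

/-- The `ℓ`-norm: the `L₂`-norm of the `L₂`-limit of the series `∑ gⱼ T eⱼ`, with the value `∞`
when the series does not converge. (The limit is unique up to null sets, so that the infimum
runs over at most one value.) -/
def ellNorm {E : Type*} [NormedAddCommGroup E] [NormedSpace 𝕜 E] (T : Ell2 𝕜 →L[𝕜] E) : ℝ≥0∞ :=
  ⨅ (f : (ℕ → ℝ) → E) (_ : MemLp f 2 gaussSeq)
    (_ : Tendsto (fun n => eLpNorm (gaussPartialSum T n - f) 2 gaussSeq) atTop (𝓝 0)),
    eLpNorm f 2 gaussSeq

/-- `E` has the Gaussian average property with constant `K`. -/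
def HasGAPWith (𝕜 : Type*) [RCLike 𝕜] (K : ℝ≥0) (E : Type*) [NormedAddCommGroup E]
    [NormedSpace 𝕜 E] : Prop :=
  ∀ T : Ell2 𝕜 →L[𝕜] E, IsFiniteRank T → ellNorm T ≤ K * pi1 (dualOp T)

/-- `E` has the Gordon-Lewis property for operators into `ℓ₂`, with constant `K`,
that is `gl₂(E) ≤ K`. -/
def HasGL2With (𝕜 : Type*) [RCLike 𝕜] (K : ℝ≥0) (E : Type*) [NormedAddCommGroup E]
    [NormedSpace 𝕜 E] : Prop :=
  ∀ T : E →L[𝕜] Ell2 𝕜, IsFiniteRank T → gamma1 T ≤ K * pi1 T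

/-- `E` is of cotype 2 with constant `K`; the average is over all choices of signs. -/
def HasCotype2With (K : ℝ≥0) (E : Type*) [NormedAddCommGroup E] : Prop :=
  ∀ (n : ℕ) (x : Fin n → E),
    Real.sqrt (∑ i, ‖x i‖ ^ 2) ≤
      K * Real.sqrt ((2 ^ n : ℝ)⁻¹ * ∑ ε : Fin n → ℤˣ, ‖∑ i, ε i • x i‖ ^ 2)

end Properties

/-- The canonical projection of the `ℓ₂`-sum of the `X n` onto its `n`-th summand, as an operator
on the `ℓ₂`-sum. -/
def sumProj (𝕜 : Type*) [RCLike 𝕜] (X : ℕ → Type*) [∀ n, NormedAddCommGroup (X n)]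
    [∀ n, NormedSpace 𝕜 (X n)] (n : ℕ) : lp X 2 →L[𝕜] lp X 2 :=
  (lp.singleContinuousLinearMap 𝕜 X 2 n).comp (lp.evalCLM 𝕜 X 2 n)

end GaussianAverage

end

/-! It suffices to bound `∑ i, ‖T (x i)‖` when only the first `N` summands of each vector are kept,
with a constant free of `N`; then `N → ∞`. Let `Tₙ` be the restriction of `T` to `X n`. Each of the
three hypotheses yields such a bound by combining an estimate on every `X n` separately through
Cauchy-Schwarz in `ℓ₂`.

GAP for the duals. Write `‖T x‖² = ∑ⱼ |fⱼ x|²` and form the random functional `Φ = ∑ⱼ gⱼ fⱼ` on the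
first `N` summands. For a fixed vector the mean of `|Φ x|` is comparable to `‖T x‖`, hence `∑ i, ‖T
(x i)‖` is at most a constant times the mean of `‖Φ‖` times the weak `ℓ₁`-norm of `x`. The norm of
`Φ` is controlled by the `ℓ₂`-sum of the norms of its components, and GAP bounds their second
moments by `π₁(Tₙ)²`. GAP involves the adjoint of an operator into the dual of `X n`, thus an
operator on the bidual; `norm_sum_bidual_le` transfers the summing estimate there by a Hahn-Banach
argument.

GL₂. Each `Tₙ` factors as `B A` through an `L₁`-space with `‖A‖ ‖B‖` close to `C π₁(Tₙ)`. On
finitely many vectors the `L₁`-spaces may be replaced by finite-dimensional `ℓ₁`. Their unit vectors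
are sent to vectors of a Hilbert space, and Grothendieck's inequality reduces the estimate to scalar
signs in place of these vectors. Such signs define functionals on the `ℓ₂`-sum, with norm at most
the `ℓ₂`-norm of the numbers `‖A‖ ‖B‖`.

Cotype 2. The `ℓ₂`-sum again has cotype 2, so by Maurey's form of Grothendieck's theorem the map `a
↦ ∑ aᵢ xᵢ` on `ℓ_∞` is dominated by a weighted `ℓ₂`-norm. Pairing the vectors `T (x i)` with norming
vectors writes `∑ ‖T (x i)‖` as a sum over `n` of traces of `Tₙ Sₙ`. A trace is at most `2 C π₁(Tₙ)`
times the Gaussian average of `Sₙ` (`trace_le`, by Pietsch domination and cotype), and the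
domination bounds the sum of the squares of these averages.

Both Grothendieck-type theorems come from one truncation argument: a Hilbert space vector is
represented by a Rademacher sum, its bounded part is handled by the hypothesis, and its tail is a
small Hilbert space vector to which the best constant applies again. -/

noncomputable section

set_option linter.unusedSectionVars false

namespace GaussianAverage

/-! ### Moments of Rademacher sums and Khintchine's inequality. -/

section Rademacher

/-- A set of reals that is bounded above and whose upper bounds improve by a contraction is bounded
by the fixed point of the contraction. -/
theorem le_of_improving_bounds {S : Set ℝ} (hS : BddAbove S) {A q : ℝ} (hq : q < 1)
    (h : ∀ D, (∀ x ∈ S, x ≤ D) → ∀ x ∈ S, x ≤ A + q * D) : ∀ x ∈ S, x ≤ A / (1 - q) := by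
  intro x hx
  have h1 : sSup S ≤ A + q * sSup S :=
    csSup_le ⟨x, hx⟩ (h _ fun y hy => le_csSup hS hy)
  have h2 : x ≤ sSup S := le_csSup hS hx
  rw [le_div_iff₀ (by linarith)]
  nlinarith

variable {κ : Type*} [Fintype κ] [DecidableEq κ]

/-- The real value of a sign. -/
abbrev sgnR (e : ℤˣ) : ℝ := ((e : ℤ) : ℝ)

theorem sgnR_sq (e : ℤˣ) : sgnR e ^ 2 = 1 := by
  rcases Int.units_eq_one_or e with rfl | rfl <;> simp [sgnR]

theorem abs_sgnR (e : ℤˣ) : |sgnR e| = 1 := by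
  rcases Int.units_eq_one_or e with rfl | rfl <;> simp [sgnR]

theorem card_signs : (Fintype.card (κ → ℤˣ) : ℝ) = 2 ^ Fintype.card κ := by
  simp

/-- Flipping one sign. -/
def flipSign (j : κ) : Equiv.Perm (κ → ℤˣ) :=
  Equiv.mulRight (Pi.mulSingle j (-1))

theorem flipSign_self (j : κ) (e : κ → ℤˣ) : flipSign j e j = - e j := by
  simp [flipSign]

theorem flipSign_ne {i j : κ} (h : i ≠ j) (e : κ → ℤˣ) : flipSign j e i = e i := by
  simp [flipSign, h]

theorem sum_sgn_mul_eq_zero (j : κ) (F : (κ → ℤˣ) → ℝ) (hF : ∀ e, F (flipSign j e) = F e) :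
    ∑ e : κ → ℤˣ, sgnR (e j) * F e = 0 := by
  have := Equiv.sum_comp (flipSign j) (fun e => sgnR (e j) * F e)
  simp only [flipSign_self, hF] at this
  simp only [sgnR, Units.val_neg, Int.cast_neg, neg_mul, Finset.sum_neg_distrib] at this ⊢
  linarith

theorem sum_signs_sq (s : Finset κ) (a : κ → ℝ) :
    ∑ e : κ → ℤˣ, (∑ j ∈ s, sgnR (e j) * a j) ^ 2 = 2 ^ Fintype.card κ * ∑ j ∈ s, a j ^ 2 := by
  induction s using Finset.induction_on with
  | empty => simp
  | insert j s hj ih =>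
    have hinv : ∀ e : κ → ℤˣ, ∑ i ∈ s, sgnR (flipSign j e i) * a i = ∑ i ∈ s, sgnR (e i) * a i :=
      fun e => Finset.sum_congr rfl fun i hi => by
        rw [flipSign_ne (ne_of_mem_of_not_mem hi hj)]
    have h0 := sum_sgn_mul_eq_zero j (fun e => 2 * a j * ∑ i ∈ s, sgnR (e i) * a i)
      (fun e => by rw [hinv])
    have : ∀ e : κ → ℤˣ, (∑ i ∈ insert j s, sgnR (e i) * a i) ^ 2
        = a j ^ 2 + sgnR (e j) * (2 * a j * ∑ i ∈ s, sgnR (e i) * a i)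
          + (∑ i ∈ s, sgnR (e i) * a i) ^ 2 := fun e => by
      rw [Finset.sum_insert hj]
      linear_combination a j ^ 2 * sgnR_sq (e j)
    simp_rw [this, Finset.sum_add_distrib]
    rw [h0, ih, Finset.sum_insert hj]
    simp
    ring

/-- Adding one term `e j * a j` kills the odd powers of this sign on average and leaves `a⁴ + 6 a² s
+ 3 s²`, where `a = a j` and `s` is the old sum of squares; this is at most `3 (a² + s)²`. -/
theorem sum_signs_pow_four_le (s : Finset κ) (a : κ → ℝ) :
    ∑ e : κ → ℤˣ, (∑ j ∈ s, sgnR (e j) * a j) ^ 4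
      ≤ 2 ^ Fintype.card κ * (3 * (∑ j ∈ s, a j ^ 2) ^ 2) := by
  induction s using Finset.induction_on with
  | empty => simp
  | insert j s hj ih =>
    have hinv : ∀ e : κ → ℤˣ, ∑ i ∈ s, sgnR (flipSign j e i) * a i = ∑ i ∈ s, sgnR (e i) * a i :=
      fun e => Finset.sum_congr rfl fun i hi => by
        rw [flipSign_ne (ne_of_mem_of_not_mem hi hj)]
    have h0 := sum_sgn_mul_eq_zero j (fun e => 4 * a j * (∑ i ∈ s, sgnR (e i) * a i) ^ 3
      + 4 * a j ^ 3 * (∑ i ∈ s, sgnR (e i) * a i)) (fun e => by rw [hinv])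
    have : ∀ e : κ → ℤˣ, (∑ i ∈ insert j s, sgnR (e i) * a i) ^ 4
        = a j ^ 4 + sgnR (e j) * (4 * a j * (∑ i ∈ s, sgnR (e i) * a i) ^ 3
            + 4 * a j ^ 3 * (∑ i ∈ s, sgnR (e i) * a i))
          + 6 * a j ^ 2 * (∑ i ∈ s, sgnR (e i) * a i) ^ 2
          + (∑ i ∈ s, sgnR (e i) * a i) ^ 4 := fun e => by
      rw [Finset.sum_insert hj]
      linear_combination (a j ^ 4 * (sgnR (e j) ^ 2 + 1)
        + 4 * sgnR (e j) * a j ^ 3 * (∑ i ∈ s, sgnR (e i) * a i)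
        + 6 * a j ^ 2 * (∑ i ∈ s, sgnR (e i) * a i) ^ 2) * sgnR_sq (e j)
    simp_rw [this, Finset.sum_add_distrib, ← Finset.mul_sum]
    rw [h0, sum_signs_sq, Finset.sum_insert hj]
    have hp : (0 : ℝ) < 2 ^ Fintype.card κ := by positivity
    simp only [Finset.sum_const, Finset.card_univ, nsmul_eq_mul, card_signs]
    have hs : 0 ≤ ∑ i ∈ s, a i ^ 2 := Finset.sum_nonneg fun _ _ => sq_nonneg _
    nlinarith [mul_nonneg hp.le (mul_nonneg (sq_nonneg (a j)) (sq_nonneg (a j)))]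

/-- Khintchine's inequality, lower `L₁`-estimate. -/
theorem sqrt_sum_sq_le_sum_signs_abs (a : κ → ℝ) :
    Real.sqrt (∑ j, a j ^ 2)
      ≤ 16 / 9 * ((2 ^ Fintype.card κ)⁻¹ * ∑ e : κ → ℤˣ, |∑ j, sgnR (e j) * a j|) := by
  set σ := Real.sqrt (∑ j, a j ^ 2) with hσ
  have hσ2 : σ ^ 2 = ∑ j, a j ^ 2 := Real.sq_sqrt (Finset.sum_nonneg fun _ _ => sq_nonneg _)
  rcases (Real.sqrt_nonneg (∑ j, a j ^ 2)).eq_or_lt with h | h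
  · rw [hσ, ← h]; positivity
  rw [← hσ] at h
  have hp : (0 : ℝ) < 2 ^ Fintype.card κ := by positivity
  -- This polynomial minorant of `|z|` touches it at `|z| = 2 σ`. Averaged with second moment `σ²`
  -- and fourth moment at most `3 σ⁴`, its left side is at least `(12 - 3) σ⁴`, whence the constant
  -- `16 / 9`.
  have hpt : ∀ z : ℝ, 12 * σ ^ 2 * z ^ 2 - z ^ 4 ≤ 16 * σ ^ 3 * |z| := fun z => by
    have h1 : 0 ≤ |z| * ((|z| - 2 * σ) ^ 2 * (|z| + 4 * σ)) := by positivity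
    have h2 : |z| * ((|z| - 2 * σ) ^ 2 * (|z| + 4 * σ))
        = (|z| ^ 2) ^ 2 - 12 * σ ^ 2 * |z| ^ 2 + 16 * σ ^ 3 * |z| := by ring
    rw [h2, sq_abs] at h1
    nlinarith
  have h4 := sum_signs_pow_four_le Finset.univ a
  have h2 := sum_signs_sq Finset.univ a
  rw [← hσ2] at h4 h2
  have h5 : ∑ e : κ → ℤˣ, (12 * σ ^ 2 * (∑ j, sgnR (e j) * a j) ^ 2 - (∑ j, sgnR (e j) * a j) ^ 4)
      ≤ ∑ e : κ → ℤˣ, 16 * σ ^ 3 * |∑ j, sgnR (e j) * a j| :=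
    Finset.sum_le_sum fun e _ => hpt _
  rw [Finset.sum_sub_distrib, ← Finset.mul_sum, ← Finset.mul_sum, h2] at h5
  have h6 : 2 ^ Fintype.card κ * (9 * σ) ≤ 16 * ∑ e : κ → ℤˣ, |∑ j, sgnR (e j) * a j| := by
    have h3 : 0 < σ ^ 3 := by positivity
    refine le_of_mul_le_mul_left ?_ h3
    nlinarith
  have h7 := mul_le_mul_of_nonneg_left h6 (inv_nonneg.2 hp.le)
  rw [← mul_assoc, inv_mul_cancel₀ hp.ne'] at h7
  linarith

end Rademacher

/-! ### Grothendieck's inequality by truncation of Rademacher sums. -/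

section Truncation

/-- Truncation of a real number at height `M`. -/
def trunc (M z : ℝ) : ℝ := if |z| ≤ M then z else 0

theorem abs_trunc_le {M : ℝ} (hM : 0 ≤ M) (z : ℝ) : |trunc M z| ≤ M := by
  unfold trunc; split_ifs with h
  · exact h
  · simpa using hM

theorem sq_sub_trunc_le {M : ℝ} (hM : 0 < M) (z : ℝ) : (z - trunc M z) ^ 2 ≤ z ^ 4 / M ^ 2 := by
  unfold trunc; split_ifs with h
  · simp; positivity
  · rw [le_div_iff₀ (by positivity), sub_zero]
    have h1 : M ^ 2 ≤ z ^ 2 := by rw [← sq_abs z]; gcongr; exact (not_le.1 h).le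
    nlinarith [sq_nonneg z]

variable {κ : Type*} [Fintype κ] [DecidableEq κ]

/-- The part of a normalized Rademacher sum above the truncation level, as a vector in the
Euclidean space over the set of signs. -/
def tailVec (M : ℝ) (b : κ → ℝ) (e : κ → ℤˣ) : ℝ :=
  (Real.sqrt (2 ^ Fintype.card κ))⁻¹ *
    ((∑ j, sgnR (e j) * b j) - trunc M (∑ j, sgnR (e j) * b j))

/-- The factor in `tailVec` turns the `L₂`-norm for the uniform measure on signs into a Euclidean
norm. The tail is then a vector over a new finite index set, and the fourth moment makes it short.
-/
theorem sum_tailVec_sq_le {M : ℝ} (hM : 0 < M) {b : κ → ℝ} (hb : ∑ j, b j ^ 2 ≤ 1) :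
    ∑ e, tailVec M b e ^ 2 ≤ 3 / M ^ 2 := by
  have hp : (0 : ℝ) < 2 ^ Fintype.card κ := by positivity
  have h4 := sum_signs_pow_four_le Finset.univ b
  have hb0 : 0 ≤ ∑ j, b j ^ 2 := Finset.sum_nonneg fun _ _ => sq_nonneg _
  calc ∑ e, tailVec M b e ^ 2
      = (2 ^ Fintype.card κ)⁻¹ * ∑ e : κ → ℤˣ,
          ((∑ j, sgnR (e j) * b j) - trunc M (∑ j, sgnR (e j) * b j)) ^ 2 := by
        rw [Finset.mul_sum]
        refine Finset.sum_congr rfl fun e _ => ?_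
        rw [tailVec, mul_pow, inv_pow, Real.sq_sqrt hp.le]
    _ ≤ (2 ^ Fintype.card κ)⁻¹ * ∑ e : κ → ℤˣ, (∑ j, sgnR (e j) * b j) ^ 4 / M ^ 2 := by
        gcongr with e; exact sq_sub_trunc_le hM _
    _ = (2 ^ Fintype.card κ)⁻¹ * (∑ e : κ → ℤˣ, (∑ j, sgnR (e j) * b j) ^ 4) / M ^ 2 := by
        rw [← Finset.sum_div, mul_div_assoc]
    _ ≤ (2 ^ Fintype.card κ)⁻¹ * (2 ^ Fintype.card κ * (3 * 1 ^ 2)) / M ^ 2 := by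
        gcongr; exact h4.trans (by gcongr)
    _ = 3 / M ^ 2 := by rw [inv_mul_cancel_left₀ hp.ne']; norm_num

/-- **Grothendieck's inequality** for real matrices, in coordinates. -/
theorem grothendieck_coord {ι : Type*} [Fintype ι] {k : ℕ} (c : Fin k → ι → ℝ) {W : ℝ}
    (hc : ∀ τ : ι → ℝ, (∀ s, |τ s| ≤ 1) → ∑ i, |∑ s, τ s * c i s| ≤ W)
    {m : ℕ} (b : ι → Fin m → ℝ) (hb : ∀ s, ∑ j, b s j ^ 2 ≤ 1) :
    ∑ i, Real.sqrt (∑ j, (∑ s, c i s * b s j) ^ 2) ≤ 23 * W := by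
  classical
  have hW : 0 ≤ W := (Finset.sum_nonneg fun _ _ => abs_nonneg _).trans (hc 0 (by simp))
  -- The index type `κ` must vary: the tails of vectors over `κ` are vectors over `κ → ℤˣ`.
  let S : Set ℝ := {D | ∃ (κ : Type) (_ : Fintype κ) (b : ι → κ → ℝ), (∀ s, ∑ j, b s j ^ 2 ≤ 1) ∧
    D = ∑ i, Real.sqrt (∑ j, (∑ s, c i s * b s j) ^ 2)}
  have hS : BddAbove S := by
    refine ⟨∑ i, Real.sqrt ((∑ s, c i s ^ 2) * Fintype.card ι), ?_⟩
    rintro _ ⟨κ, _, b, hb, rfl⟩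
    refine Finset.sum_le_sum fun i _ => Real.sqrt_le_sqrt ?_
    calc ∑ j, (∑ s, c i s * b s j) ^ 2 ≤ ∑ j, (∑ s, c i s ^ 2) * ∑ s, b s j ^ 2 :=
          Finset.sum_le_sum fun j _ => Finset.sum_mul_sq_le_sq_mul_sq _ _ _
      _ = (∑ s, c i s ^ 2) * ∑ s, ∑ j, b s j ^ 2 := by rw [← Finset.mul_sum, Finset.sum_comm]
      _ ≤ (∑ s, c i s ^ 2) * ∑ s : ι, 1 := by gcongr with s; exact hb s
      _ = _ := by simp
  -- Truncation at height `7` gives `D ↦ 16/9 * (7 W + D/4)`; its fixed point `112/5 * W` is below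
  -- `23 * W`.
  have key := le_of_improving_bounds hS (A := 16 / 9 * 7 * W) (q := 4 / 9) (by norm_num) ?_
  · refine (key _ ⟨Fin m, _, b, hb, rfl⟩).trans ?_
    norm_num
    nlinarith
  rintro D hD _ ⟨κ, _, b, hb, rfl⟩
  have hp : (0 : ℝ) < 2 ^ Fintype.card κ := by positivity
  set Z : ι → (κ → ℤˣ) → ℝ := fun s e => ∑ j, sgnR (e j) * b s j with hZ
  set ρ : ι → (κ → ℤˣ) → ℝ := fun s => tailVec 7 (b s) with hρ
  have hdecomp : ∀ s e, Z s e = trunc 7 (Z s e) + Real.sqrt (2 ^ Fintype.card κ) * ρ s e := by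
    intro s e
    simp only [hρ, tailVec, hZ]
    rw [mul_inv_cancel_left₀ (by positivity)]; ring
  -- The tails have squared norm at most `3 / 49 ≤ 1 / 16`, so four times a tail is admissible in
  -- `S`.
  have htail : ∑ i, Real.sqrt (∑ e, (∑ s, c i s * ρ s e) ^ 2) ≤ D / 4 := by
    have := hD _ ⟨κ → ℤˣ, inferInstance, fun s e => 4 * ρ s e, fun s => ?_, rfl⟩
    · have h4 : ∀ i, Real.sqrt (∑ e, (∑ s, c i s * (4 * ρ s e)) ^ 2)
          = 4 * Real.sqrt (∑ e, (∑ s, c i s * ρ s e) ^ 2) := fun i => by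
        have : ∀ e, (∑ s, c i s * (4 * ρ s e)) ^ 2 = 4 ^ 2 * (∑ s, c i s * ρ s e) ^ 2 := fun e => by
          rw [← mul_pow, Finset.mul_sum]
          congr 1; exact Finset.sum_congr rfl fun s _ => by ring
        simp_rw [this]
        rw [← Finset.mul_sum, Real.sqrt_mul (by norm_num), Real.sqrt_sq (by norm_num)]
      simp_rw [h4, ← Finset.mul_sum] at this
      linarith
    · have := sum_tailVec_sq_le (M := 7) (by norm_num) (hb s)
      simp_rw [mul_pow, ← Finset.mul_sum]
      simp only [hρ]
      norm_num at this ⊢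
      linarith
  have hmain : ∀ i, Real.sqrt (∑ j, (∑ s, c i s * b s j) ^ 2) ≤
      16 / 9 * ((2 ^ Fintype.card κ)⁻¹ * ∑ e, |∑ s, trunc 7 (Z s e) * c i s|)
      + 16 / 9 * Real.sqrt (∑ e, (∑ s, c i s * ρ s e) ^ 2) := fun i => by
    refine (sqrt_sum_sq_le_sum_signs_abs fun j => ∑ s, c i s * b s j).trans ?_
    rw [← mul_add]
    gcongr
    have hsw : ∀ e : κ → ℤˣ, |∑ j, sgnR (e j) * ∑ s, c i s * b s j| ≤
        |∑ s, trunc 7 (Z s e) * c i s| + Real.sqrt (2 ^ Fintype.card κ) * |∑ s, c i s * ρ s e| := by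
      intro e
      have : ∑ j, sgnR (e j) * ∑ s, c i s * b s j
          = ∑ s, trunc 7 (Z s e) * c i s
            + Real.sqrt (2 ^ Fintype.card κ) * ∑ s, c i s * ρ s e := by
        calc ∑ j, sgnR (e j) * ∑ s, c i s * b s j = ∑ s, c i s * Z s e := by
              simp_rw [hZ, Finset.mul_sum]
              rw [Finset.sum_comm]
              exact Finset.sum_congr rfl fun s _ => Finset.sum_congr rfl fun j _ => by ring
          _ = _ := by
              rw [Finset.mul_sum, ← Finset.sum_add_distrib]
              exact Finset.sum_congr rfl fun s _ => by linear_combination c i s * hdecomp s e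
      rw [this]
      refine (abs_add_le _ _).trans ?_
      rw [abs_mul, abs_of_nonneg (Real.sqrt_nonneg _)]
    calc (2 ^ Fintype.card κ)⁻¹ * ∑ e : κ → ℤˣ, |∑ j, sgnR (e j) * ∑ s, c i s * b s j|
        ≤ (2 ^ Fintype.card κ)⁻¹ * ∑ e : κ → ℤˣ, (|∑ s, trunc 7 (Z s e) * c i s|
            + Real.sqrt (2 ^ Fintype.card κ) * |∑ s, c i s * ρ s e|) := by
          gcongr with e; exact hsw e
      _ = (2 ^ Fintype.card κ)⁻¹ * ∑ e, |∑ s, trunc 7 (Z s e) * c i s|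
            + (Real.sqrt (2 ^ Fintype.card κ))⁻¹ * ∑ e, |∑ s, c i s * ρ s e| := by
          rw [Finset.sum_add_distrib, mul_add, ← Finset.mul_sum, ← mul_assoc]
          congr 2
          nth_rw 1 [← Real.sq_sqrt hp.le]
          field_simp
      _ ≤ _ := by
          gcongr
          rw [inv_mul_le_iff₀ (by positivity), ← Real.sqrt_mul hp.le]
          refine Real.le_sqrt_of_sq_le ?_
          have := sq_sum_le_card_mul_sum_sq (s := (Finset.univ : Finset (κ → ℤˣ)))
            (f := fun e => |∑ s, c i s * ρ s e|)
          simpa [Finset.card_univ, sq_abs] using this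
  calc _ ≤ ∑ i, (16 / 9 * ((2 ^ Fintype.card κ)⁻¹ * ∑ e, |∑ s, trunc 7 (Z s e) * c i s|)
      + 16 / 9 * Real.sqrt (∑ e, (∑ s, c i s * ρ s e) ^ 2)) := Finset.sum_le_sum fun i _ => hmain i
    _ = 16 / 9 * ((2 ^ Fintype.card κ)⁻¹ * ∑ e, ∑ i, |∑ s, trunc 7 (Z s e) * c i s|)
        + 16 / 9 * ∑ i, Real.sqrt (∑ e, (∑ s, c i s * ρ s e) ^ 2) := by
        rw [Finset.sum_add_distrib, ← Finset.mul_sum, ← Finset.mul_sum, ← Finset.mul_sum,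
          Finset.sum_comm]
    _ ≤ 16 / 9 * ((2 ^ Fintype.card κ)⁻¹ * ∑ e : κ → ℤˣ, 7 * W) + 16 / 9 * (D / 4) := by
        gcongr with e
        have := hc (fun s => trunc 7 (Z s e) / 7) fun s => by
          rw [abs_div, abs_of_pos (by norm_num : (0 : ℝ) < 7), div_le_one (by norm_num)]
          exact abs_trunc_le (by norm_num) _
        have h7 : ∀ i, |∑ s, trunc 7 (Z s e) / 7 * c i s| = |∑ s, trunc 7 (Z s e) * c i s| / 7 :=
          fun i => by
            rw [← abs_of_pos (by norm_num : (0 : ℝ) < 7), ← abs_div, Finset.sum_div,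
              abs_of_pos (by norm_num : (0 : ℝ) < 7)]
            congr 1; exact Finset.sum_congr rfl fun s _ => by ring
        simp_rw [h7, ← Finset.sum_div] at this
        linarith
    _ = 16 / 9 * 7 * W + 4 / 9 * D := by
        simp only [Finset.sum_const, Finset.card_univ, nsmul_eq_mul, card_signs]
        rw [inv_mul_cancel_left₀ hp.ne']; ring

end Truncation

/-! ### Minimax by separation. -/

section Minimax

/-- A finite-dimensional minimax principle: if every function in a convex set of real functions on a
finite set is somewhere nonnegative, then some probability vector integrates all of them to a
nonnegative number. -/
theorem exists_probability_of_convex {Λ : Type*} [Fintype Λ] [Nonempty Λ] (A : Set (Λ → ℝ))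
    (hA : Convex ℝ A) (h : ∀ a ∈ A, ∃ t, 0 ≤ a t) :
    ∃ μ : Λ → ℝ, (∀ t, 0 ≤ μ t) ∧ ∑ t, μ t = 1 ∧ ∀ a ∈ A, 0 ≤ ∑ t, μ t * a t := by
  classical
  rcases A.eq_empty_or_nonempty with rfl | ⟨a₀, ha₀⟩
  · obtain ⟨t₀⟩ := ‹Nonempty Λ›
    exact ⟨Pi.single t₀ 1, fun t => by by_cases ht : t = t₀ <;> simp [ht],
      by simp, by simp⟩
  -- The functional separating `A` from the open negative orthant has nonnegative coefficients;
  -- normalized, they are the probability vector.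
  let N : Set (Λ → ℝ) := Set.univ.pi fun _ => Set.Iio 0
  have hN : IsOpen N := isOpen_set_pi Set.finite_univ fun _ _ => isOpen_Iio
  have hNc : Convex ℝ N := convex_pi fun _ _ => convex_Iio _
  have hdisj : Disjoint N A := Set.disjoint_left.2 fun a ha haA => by
    obtain ⟨t, ht⟩ := h a haA
    exact absurd (ha t trivial) (not_lt.2 ht)
  obtain ⟨f, u, hfN, hfA⟩ := geometric_hahn_banach_open hNc hN hA hdisj
  have hrep : ∀ a : Λ → ℝ, f a = ∑ t, f (Pi.single t 1) * a t := fun a => by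
    have ha : a = ∑ t, a t • (Pi.single t (1 : ℝ) : Λ → ℝ) := by
      ext s; simp [Finset.sum_apply, Pi.single_apply]
    conv_lhs => rw [ha]
    rw [map_sum]
    exact Finset.sum_congr rfl fun t _ => by rw [map_smul, smul_eq_mul, mul_comm]
  have hneg : ∀ a : Λ → ℝ, (∀ t, a t ≤ 0) → f a ≤ u := fun a ha => by
    have hlim : Tendsto (fun s : ℝ => f (a + s • fun _ => (-1 : ℝ))) (𝓝[>] 0) (𝓝 (f a)) := by
      have : Tendsto (fun s : ℝ => f (a + s • fun _ => (-1 : ℝ))) (𝓝 0)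
          (𝓝 (f (a + (0 : ℝ) • fun _ => (-1 : ℝ)))) :=
        (f.continuous.comp (by fun_prop)).tendsto 0
      simp only [zero_smul, add_zero] at this
      exact this.mono_left nhdsWithin_le_nhds
    refine le_of_tendsto hlim ?_
    filter_upwards [self_mem_nhdsWithin] with s hs
    refine (hfN _ fun t _ => ?_).le
    have := ha t
    have hs' : (0 : ℝ) < s := hs
    simp; linarith
  have hu : 0 ≤ u := by simpa using hneg 0 (by simp)
  have hcone : ∀ a : Λ → ℝ, (∀ t, a t ≤ 0) → f a ≤ 0 := fun a ha => by
    by_contra hpos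
    push Not at hpos
    have := hneg (((u + 1) / f a) • a) fun t => by
      simpa using mul_nonpos_of_nonneg_of_nonpos (by positivity) (ha t)
    rw [map_smul, smul_eq_mul, div_mul_cancel₀ _ hpos.ne'] at this
    linarith
  have hμ0 : ∀ t, 0 ≤ f (Pi.single t 1) := fun t => by
    have := hcone (-Pi.single t 1) fun s => by
      by_cases hs : s = t <;> simp [hs]
    rw [map_neg] at this; linarith
  -- With all coefficients zero, `f` would vanish, against its strict separation of `N` from the
  -- point `a₀` of `A`.
  have hsum : 0 < ∑ t, f (Pi.single t 1) := by
    refine (Finset.sum_nonneg fun t _ => hμ0 t).lt_of_ne fun h0 => ?_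
    have h1 : ∀ t, f (Pi.single t 1) = 0 := fun t =>
      (Finset.sum_eq_zero_iff_of_nonneg fun t _ => hμ0 t).1 h0.symm t (Finset.mem_univ t)
    have h2 := hfN (fun _ => -1) fun t _ => by simp
    have h3 := hfA a₀ ha₀
    rw [hrep] at h2 h3
    simp [h1] at h2 h3
    linarith
  refine ⟨fun t => f (Pi.single t 1) / ∑ s, f (Pi.single s 1), fun t => div_nonneg (hμ0 t) hsum.le,
    by rw [← Finset.sum_div, div_self hsum.ne'], fun a ha => ?_⟩
  have : ∑ t, f (Pi.single t 1) / (∑ s, f (Pi.single s 1)) * a t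
      = f a / ∑ s, f (Pi.single s 1) := by
    rw [hrep a, Finset.sum_div]
    exact Finset.sum_congr rfl fun t _ => by ring
  rw [this]
  exact div_nonneg (hu.trans (hfA a ha)) hsum.le

end Minimax

/-! ### Operators from `ℓ_∞` into spaces of cotype 2. -/

section Cotype

variable {E : Type*} [NormedAddCommGroup E] [NormedSpace ℝ E]

theorem units_smul_eq (e : ℤˣ) (x : E) : e • x = sgnR e • x := by
  rcases Int.units_eq_one_or e with rfl | rfl <;> simp [sgnR]

theorem HasCotype2With.sum_sq_le {C : ℝ≥0} (hE : HasCotype2With C E) {κ : Type*} [Fintype κ]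
    [DecidableEq κ] (x : κ → E) :
    ∑ i, ‖x i‖ ^ 2 ≤
      C ^ 2 * ((2 ^ Fintype.card κ : ℝ)⁻¹ * ∑ e : κ → ℤˣ, ‖∑ i, sgnR (e i) • x i‖ ^ 2) := by
  let φ := Fintype.equivFin κ
  have h := hE _ (fun i => x (φ.symm i))
  have h1 : ∑ i, ‖x (φ.symm i)‖ ^ 2 = ∑ i, ‖x i‖ ^ 2 :=
    Equiv.sum_comp φ.symm fun i => ‖x i‖ ^ 2
  have h2 : ∑ e : Fin (Fintype.card κ) → ℤˣ, ‖∑ i, e i • x (φ.symm i)‖ ^ 2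
      = ∑ e : κ → ℤˣ, ‖∑ i, sgnR (e i) • x i‖ ^ 2 := by
    refine Fintype.sum_equiv (φ.arrowCongr (Equiv.refl _)).symm _ _ fun e => ?_
    rw [← Equiv.sum_comp φ.symm]
    simp [units_smul_eq]
  rw [h1, h2] at h
  have h3 : (0 : ℝ) ≤ (2 ^ Fintype.card κ : ℝ)⁻¹ * ∑ e : κ → ℤˣ, ‖∑ i, sgnR (e i) • x i‖ ^ 2 := by
    positivity
  have h4 := pow_le_pow_left₀ (Real.sqrt_nonneg _) h 2
  rwa [mul_pow, Real.sq_sqrt (by positivity), Real.sq_sqrt h3] at h4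

theorem norm_add_sq_le (x y : E) : ‖x + y‖ ^ 2 ≤ 2 * ‖x‖ ^ 2 + 2 * ‖y‖ ^ 2 := by
  nlinarith [norm_add_le x y, sq_nonneg (‖x‖ - ‖y‖), norm_nonneg (x + y)]

/-- Rademacher form of the Maurey-Grothendieck theorem: an operator from `ℓ_∞` into a space of
cotype 2 maps Rademacher processes with variances at most one to bounded averages. -/
theorem HasCotype2With.signs_average_le {C : ℝ≥0} (hE : HasCotype2With C E) {k : ℕ}
    (x : Fin k → E) {W : ℝ} (hx : ∀ τ : Fin k → ℝ, (∀ i, |τ i| ≤ 1) → ‖∑ i, τ i • x i‖ ≤ W)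
    {m : ℕ} (b : Fin k → Fin m → ℝ) (hb : ∀ i, ∑ j, b i j ^ 2 ≤ 1) :
    (2 ^ m : ℝ)⁻¹ * ∑ e : Fin m → ℤˣ, ‖∑ i, (∑ j, sgnR (e j) * b i j) • x i‖ ^ 2
      ≤ 4 * (4 * C + 1) ^ 2 * W ^ 2 := by
  classical
  have hW : 0 ≤ W := (norm_nonneg _).trans (hx 0 (by simp))
  -- The level is chosen so that `4 C² ≤ (M / 2)²`: cotype costs a factor `C²` on the tail, and this
  -- leaves a quarter of `D`.
  set M : ℝ := 4 * C + 1 with hM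
  have hC : (0 : ℝ) ≤ C := C.2
  have hMpos : 0 < M := by positivity
  let S : Set ℝ := {D | ∃ (κ : Type) (_ : Fintype κ) (_ : DecidableEq κ) (b : Fin k → κ → ℝ),
    (∀ s, ∑ j, b s j ^ 2 ≤ 1) ∧ D = (2 ^ Fintype.card κ : ℝ)⁻¹ * ∑ e : κ → ℤˣ,
      ‖∑ i, (∑ j, sgnR (e j) * b i j) • x i‖ ^ 2}
  have hS : BddAbove S := by
    refine ⟨k * ∑ i, ‖x i‖ ^ 2, ?_⟩
    rintro _ ⟨κ, _, _, b, hb, rfl⟩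
    have hp : (0 : ℝ) < 2 ^ Fintype.card κ := by positivity
    rw [inv_mul_le_iff₀ hp]
    calc ∑ e : κ → ℤˣ, ‖∑ i, (∑ j, sgnR (e j) * b i j) • x i‖ ^ 2
        ≤ ∑ e : κ → ℤˣ, (∑ i, (∑ j, sgnR (e j) * b i j) ^ 2) * ∑ i, ‖x i‖ ^ 2 := by
          gcongr with e
          calc ‖∑ i, (∑ j, sgnR (e j) * b i j) • x i‖ ^ 2
              ≤ (∑ i, |∑ j, sgnR (e j) * b i j| * ‖x i‖) ^ 2 := by
                gcongr
                refine (norm_sum_le _ _).trans_eq ?_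
                simp [norm_smul]
            _ ≤ _ := by
                refine (Finset.sum_mul_sq_le_sq_mul_sq _ _ _).trans_eq ?_
                simp
      _ = (∑ i, ∑ e : κ → ℤˣ, (∑ j, sgnR (e j) * b i j) ^ 2) * ∑ i, ‖x i‖ ^ 2 := by
          rw [← Finset.sum_mul, Finset.sum_comm]
      _ ≤ (∑ i : Fin k, 2 ^ Fintype.card κ * 1) * ∑ i, ‖x i‖ ^ 2 := by
          gcongr with i
          rw [sum_signs_sq]; gcongr; exact hb i
      _ = _ := by simp; ring
  -- The improvement is `D ↦ 2 M² W² + D / 2`, with fixed point `4 M² W²`.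
  have key := le_of_improving_bounds hS (A := 2 * M ^ 2 * W ^ 2) (q := 1 / 2) (by norm_num) ?_
  · refine (key _ ⟨Fin m, inferInstance, inferInstance, b, hb, by simp⟩).trans_eq ?_
    ring
  rintro D hD _ ⟨κ, _, _, b, hb, rfl⟩
  have hp : (0 : ℝ) < 2 ^ Fintype.card κ := by positivity
  set Z : Fin k → (κ → ℤˣ) → ℝ := fun s e => ∑ j, sgnR (e j) * b s j with hZ
  set ρ : Fin k → (κ → ℤˣ) → ℝ := fun s => tailVec M (b s) with hρ
  set r := Real.sqrt (2 ^ Fintype.card κ) with hr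
  have hr2 : r ^ 2 = 2 ^ Fintype.card κ := Real.sq_sqrt hp.le
  have hdecomp : ∀ s e, Z s e = trunc M (Z s e) + r * ρ s e := by
    intro s e
    simp only [hρ, tailVec, hZ]
    rw [mul_inv_cancel_left₀ (by positivity)]; ring
  have htail : ∑ e, ‖∑ i, ρ i e • x i‖ ^ 2 ≤ D / 4 := by
    -- Cotype is applied to the values of the tail process at all sign patterns `e`. This produces a
    -- new Rademacher process over `κ → ℤˣ`, to which the bound `D` applies after rescaling by `M /
    -- 2`.
    have h1 := hE.sum_sq_le fun e => ∑ i, ρ i e • x i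
    have h2 : ∀ e' : (κ → ℤˣ) → ℤˣ, ∑ e, sgnR (e' e) • ∑ i, ρ i e • x i
        = ∑ i, (∑ e, sgnR (e' e) * ρ i e) • x i := fun e' => by
      simp_rw [Finset.smul_sum, Finset.sum_smul, smul_smul]
      rw [Finset.sum_comm]
    simp_rw [h2] at h1
    refine h1.trans ?_
    have h3 := hD _ ⟨κ → ℤˣ, inferInstance, inferInstance, fun s e => (M / 2) * ρ s e,
      fun s => ?_, rfl⟩
    · have h4 : ∀ e' : (κ → ℤˣ) → ℤˣ, ‖∑ i, (∑ e, sgnR (e' e) * (M / 2 * ρ i e)) • x i‖ ^ 2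
          = (M / 2) ^ 2 * ‖∑ i, (∑ e, sgnR (e' e) * ρ i e) • x i‖ ^ 2 := fun e' => by
        have : ∑ i, (∑ e, sgnR (e' e) * (M / 2 * ρ i e)) • x i
            = (M / 2) • ∑ i, (∑ e, sgnR (e' e) * ρ i e) • x i := by
          rw [Finset.smul_sum]
          refine Finset.sum_congr rfl fun i _ => ?_
          rw [smul_smul, Finset.mul_sum]
          congr 1; exact Finset.sum_congr rfl fun s _ => by ring
        rw [this, norm_smul, mul_pow, Real.norm_eq_abs, sq_abs]
      simp_rw [h4] at h3
      rw [← Finset.mul_sum, ← mul_assoc, mul_comm _ ((M / 2) ^ 2), mul_assoc] at h3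
      set Q := (2 ^ Fintype.card (κ → ℤˣ) : ℝ)⁻¹ *
        ∑ e' : (κ → ℤˣ) → ℤˣ, ‖∑ i, (∑ e, sgnR (e' e) * ρ i e) • x i‖ ^ 2 with hQ
      have hQ0 : 0 ≤ Q := by positivity
      have : (C : ℝ) ^ 2 * 4 ≤ (M / 2) ^ 2 := by rw [hM]; nlinarith
      nlinarith
    · have := sum_tailVec_sq_le hMpos (hb s)
      simp_rw [mul_pow, ← Finset.mul_sum]
      calc (M / 2) ^ 2 * ∑ e, ρ s e ^ 2 ≤ (M / 2) ^ 2 * (3 / M ^ 2) := by gcongr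
        _ = 3 / 4 := by field_simp; norm_num
        _ ≤ 1 := by norm_num
  calc (2 ^ Fintype.card κ : ℝ)⁻¹ * ∑ e : κ → ℤˣ, ‖∑ i, Z i e • x i‖ ^ 2
      ≤ (2 ^ Fintype.card κ : ℝ)⁻¹ * ∑ e : κ → ℤˣ,
          (2 * (M * W) ^ 2 + 2 * (r ^ 2 * ‖∑ i, ρ i e • x i‖ ^ 2)) := by
        gcongr with e
        have h1 : ∑ i, Z i e • x i = ∑ i, trunc M (Z i e) • x i + r • ∑ i, ρ i e • x i := by
          rw [Finset.smul_sum, ← Finset.sum_add_distrib]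
          refine Finset.sum_congr rfl fun i _ => ?_
          rw [smul_smul, ← add_smul, ← hdecomp]
        have h2 : ‖∑ i, trunc M (Z i e) • x i‖ ≤ M * W := by
          have := hx (fun i => trunc M (Z i e) / M) fun i => by
            rw [abs_div, abs_of_pos hMpos, div_le_one hMpos]
            exact abs_trunc_le hMpos.le _
          have h3 : ∑ i, trunc M (Z i e) • x i = M • ∑ i, (trunc M (Z i e) / M) • x i := by
            rw [Finset.smul_sum]
            refine Finset.sum_congr rfl fun i _ => ?_
            rw [smul_smul, mul_div_cancel₀ _ hMpos.ne']
          rw [h3, norm_smul, Real.norm_eq_abs, abs_of_pos hMpos]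
          gcongr
        rw [h1]
        refine (norm_add_sq_le _ _).trans ?_
        rw [norm_smul r, mul_pow, Real.norm_eq_abs, sq_abs]
        gcongr
    _ = 2 * M ^ 2 * W ^ 2 + 2 * ∑ e, ‖∑ i, ρ i e • x i‖ ^ 2 := by
        rw [Finset.sum_add_distrib, hr2, ← Finset.mul_sum, ← Finset.mul_sum]
        simp only [Finset.sum_const, Finset.card_univ, nsmul_eq_mul, card_signs]
        field_simp
        rw [mul_add, Finset.mul_sum]
        ring
    _ ≤ 2 * M ^ 2 * W ^ 2 + 1 / 2 * D := by linarith

/-- Maurey's extension of Grothendieck's theorem: operators from `ℓ_∞^k` into a space of cotype 2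
are dominated by a Hilbertian norm. -/
theorem HasCotype2With.exists_weights {C : ℝ≥0} (hE : HasCotype2With C E) {k : ℕ} [NeZero k]
    (x : Fin k → E) {W : ℝ} (hx : ∀ τ : Fin k → ℝ, (∀ i, |τ i| ≤ 1) → ‖∑ i, τ i • x i‖ ≤ W) :
    ∃ μ : Fin k → ℝ, (∀ i, 0 ≤ μ i) ∧ ∑ i, μ i = 1 ∧ ∀ a : Fin k → ℝ,
      ‖∑ i, a i • x i‖ ^ 2 ≤ C ^ 2 * (4 * (4 * C + 1) ^ 2 * W ^ 2) * ∑ i, μ i * a i ^ 2 := by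
  classical
  set B : ℝ := C ^ 2 * (4 * (4 * C + 1) ^ 2 * W ^ 2) with hB
  have hB0 : 0 ≤ B := by positivity
  have hsum : ∀ (M : ℕ) (a : Fin M → Fin k → ℝ), (∀ i, ∑ l, a l i ^ 2 ≤ 1) →
      ∑ l, ‖∑ i, a l i • x i‖ ^ 2 ≤ B := fun M a ha => by
    refine (hE.sum_sq_le fun l => ∑ i, a l i • x i).trans ?_
    have h2 : ∀ e : Fin M → ℤˣ, ∑ l, sgnR (e l) • ∑ i, a l i • x i
        = ∑ i, (∑ l, sgnR (e l) * a l i) • x i := fun e' => by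
      simp_rw [Finset.smul_sum, Finset.sum_smul, smul_smul]
      rw [Finset.sum_comm]
    simp_rw [h2, Fintype.card_fin]
    exact mul_le_mul_of_nonneg_left (hE.signs_average_le x hx (fun i l => a l i) ha) (by positivity)
  let A : Set (Fin k → ℝ) := {f | ∃ (M : ℕ) (a : Fin M → Fin k → ℝ),
    f = fun i => B * ∑ l, a l i ^ 2 - ∑ l, ‖∑ i, a l i • x i‖ ^ 2}
  have hA : Convex ℝ A := by
    rintro _ ⟨M, a, rfl⟩ _ ⟨M', a', rfl⟩ s s' hs hs' -
    -- The functions in `A` are quadratic in the family `a`, so a convex combination comes from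
    -- concatenating families scaled by square roots of the weights.
    refine ⟨M + M', Fin.append (fun l => Real.sqrt s • a l) (fun l => Real.sqrt s' • a' l), ?_⟩
    have hsc : ∀ (s : ℝ) (a : Fin k → ℝ), 0 ≤ s → ‖∑ i, (Real.sqrt s • a) i • x i‖ ^ 2
        = s * ‖∑ i, a i • x i‖ ^ 2 := fun s a hs => by
      have : ∑ i, (Real.sqrt s • a) i • x i = Real.sqrt s • ∑ i, a i • x i := by
        rw [Finset.smul_sum]
        exact Finset.sum_congr rfl fun i _ => by rw [smul_smul]; rfl
      rw [this, norm_smul, mul_pow, Real.norm_eq_abs, sq_abs, Real.sq_sqrt hs]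
    ext i
    simp only [Fin.sum_univ_add, Fin.append_left, Fin.append_right, hsc _ _ hs, hsc _ _ hs']
    simp only [Pi.add_apply, Pi.smul_apply, smul_eq_mul, mul_pow, Real.sq_sqrt hs,
      Real.sq_sqrt hs', ← Finset.mul_sum]
    ring
  have hne : ∀ f ∈ A, ∃ i, 0 ≤ f i := by
    rintro _ ⟨M, a, rfl⟩
    -- At the coordinate with the largest square sum `V`, the value is nonnegative: `hsum` applies
    -- to the family divided by `√V`.
    obtain ⟨i₀, -, hi₀⟩ := Finset.exists_max_image Finset.univ (fun i => ∑ l, a l i ^ 2)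
      ⟨(0 : Fin k), Finset.mem_univ _⟩
    refine ⟨i₀, ?_⟩
    simp only at hi₀ ⊢
    set V := ∑ l, a l i₀ ^ 2 with hV
    have hV0 : 0 ≤ V := Finset.sum_nonneg fun _ _ => sq_nonneg _
    rcases hV0.eq_or_lt with h0 | hpos
    · have ha : ∀ l i, a l i = 0 := fun l i => by
        have h1 : ∑ l, a l i ^ 2 = 0 :=
          le_antisymm ((hi₀ i (Finset.mem_univ i)).trans h0.symm.le)
            (Finset.sum_nonneg fun _ _ => sq_nonneg _)
        exact pow_eq_zero_iff two_ne_zero |>.1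
          ((Finset.sum_eq_zero_iff_of_nonneg fun _ _ => sq_nonneg _).1 h1 l (Finset.mem_univ l))
      simp [← h0, ha]
    have h1 := hsum M (fun l i => (Real.sqrt V)⁻¹ * a l i) fun i => by
      simp_rw [mul_pow, ← Finset.mul_sum, inv_pow, Real.sq_sqrt hV0]
      rw [inv_mul_le_iff₀ hpos, mul_one]
      exact hi₀ i (Finset.mem_univ i)
    have h2 : ∀ l, ‖∑ i, ((Real.sqrt V)⁻¹ * a l i) • x i‖ ^ 2 = V⁻¹ * ‖∑ i, a l i • x i‖ ^ 2 :=
      fun l => by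
        simp_rw [← smul_smul]
        rw [← Finset.smul_sum, norm_smul, mul_pow, Real.norm_eq_abs, sq_abs, inv_pow,
          Real.sq_sqrt hV0]
    simp_rw [h2, ← Finset.mul_sum] at h1
    rw [inv_mul_le_iff₀ hpos] at h1
    linarith
  obtain ⟨μ, hμ0, hμ1, hμ⟩ := exists_probability_of_convex A hA hne
  refine ⟨μ, hμ0, hμ1, fun a => ?_⟩
  have := hμ _ ⟨1, fun _ => a, rfl⟩
  simp only [Fin.sum_univ_one, mul_sub, Finset.sum_sub_distrib, ← Finset.sum_mul, hμ1] at this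
  rw [Finset.mul_sum]
  have h2 : ∑ i, μ i * (B * a i ^ 2) = ∑ i, B * (μ i * a i ^ 2) :=
    Finset.sum_congr rfl fun i _ => by ring
  linarith

end Cotype

/-! ### Gaussian averages in spaces of cotype 2. -/

section Gaussian

theorem integral_inner_sq_stdGaussian {V : Type*} [NormedAddCommGroup V] [InnerProductSpace ℝ V]
    [FiniteDimensional ℝ V] [MeasurableSpace V] [BorelSpace V] (h : V) :
    ∫ g, inner ℝ h g ^ 2 ∂(stdGaussian V) = ‖h‖ ^ 2 := by
  have h1 := variance_dual_stdGaussian (innerSL ℝ h)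
  rw [variance_of_integral_eq_zero (by fun_prop) (integral_strongDual_stdGaussian _)] at h1
  simpa using h1

theorem integrable_norm_sq_stdGaussian {V : Type*} [NormedAddCommGroup V] [InnerProductSpace ℝ V]
    [FiniteDimensional ℝ V] [MeasurableSpace V] [BorelSpace V]
    {E : Type*} [NormedAddCommGroup E] [NormedSpace ℝ E] (S : V →ₗ[ℝ] E) :
    Integrable (fun g => ‖S g‖ ^ 2) (stdGaussian V) := by
  let S' : V →L[ℝ] E := LinearMap.toContinuousLinearMap S
  have h2 : MemLp (fun g : V => g) 2 (stdGaussian V) := IsGaussian.memLp_two_id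
  have h3 : Integrable (fun g : V => ‖S'‖ ^ 2 * ‖g‖ ^ 2) (stdGaussian V) :=
    (h2.integrable_norm_pow (by norm_num)).const_mul _
  refine h3.mono' ?_ (Eventually.of_forall fun g => ?_)
  · exact (S'.continuous.norm.pow 2).aestronglyMeasurable
  · rw [Real.norm_eq_abs, abs_of_nonneg (by positivity), ← mul_pow]
    gcongr
    exact S'.le_opNorm g

variable {κ : Type*} [Fintype κ] {m : ℕ}

/-- If `A` is an isometry then its adjoint maps the standard Gaussian law to the standard
Gaussian law. -/
theorem stdGaussian_map_adjoint (A : EuclideanSpace ℝ (Fin m) →L[ℝ] EuclideanSpace ℝ κ)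
    (hA : ∀ h, ‖A h‖ = ‖h‖) :
    (stdGaussian (EuclideanSpace ℝ κ)).map A.adjoint = stdGaussian (EuclideanSpace ℝ (Fin m)) := by
  have := Measure.isProbabilityMeasure_map (μ := stdGaussian (EuclideanSpace ℝ κ))
    A.adjoint.continuous.aemeasurable
  refine Measure.ext_of_charFun (funext fun t => ?_)
  rw [charFun_stdGaussian, charFun_apply, integral_map A.adjoint.continuous.aemeasurable
    (Continuous.aestronglyMeasurable (by fun_prop))]
  simp_rw [ContinuousLinearMap.adjoint_inner_left]
  rw [← charFun_apply, charFun_stdGaussian, hA]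

/-- Changing the signs of coordinates. -/
def signIsometry (e : κ → ℤˣ) : EuclideanSpace ℝ κ ≃ₗᵢ[ℝ] EuclideanSpace ℝ κ :=
  LinearIsometryEquiv.piLpCongrRight 2 fun t =>
    if e t = 1 then LinearIsometryEquiv.refl ℝ ℝ else LinearIsometryEquiv.neg ℝ

theorem signIsometry_apply (e : κ → ℤˣ) (g : EuclideanSpace ℝ κ) (t : κ) :
    signIsometry e g t = sgnR (e t) * g t := by
  rcases Int.units_eq_one_or (e t) with h | h <;> simp [signIsometry, h, sgnR]

variable {E : Type*} [NormedAddCommGroup E] [NormedSpace ℝ E]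

theorem euclidean_sum_single [DecidableEq κ] (g : EuclideanSpace ℝ κ) :
    g = ∑ t, g t • EuclideanSpace.single t (1 : ℝ) := by
  ext s
  simp [Finset.sum_apply, Pi.single_apply]

/-- Cotype is applied pointwise to the vectors `g t • U eₜ`. The standard Gaussian law is invariant
under sign changes, so averaging over signs is free, and each `g t` has second moment one. -/
theorem HasCotype2With.sum_sq_le_integral_coord {C : ℝ≥0} (hE : HasCotype2With C E) [DecidableEq κ]
    (U : EuclideanSpace ℝ κ →ₗ[ℝ] E) :
    ∑ t, ‖U (EuclideanSpace.single t 1)‖ ^ 2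
      ≤ C ^ 2 * ∫ g, ‖U g‖ ^ 2 ∂(stdGaussian (EuclideanSpace ℝ κ)) := by
  have hp : (0 : ℝ) < 2 ^ Fintype.card κ := by positivity
  have hint := integrable_norm_sq_stdGaussian U
  have hsign : ∀ e : κ → ℤˣ, ∫ g, ‖U (signIsometry e g)‖ ^ 2 ∂(stdGaussian (EuclideanSpace ℝ κ))
      = ∫ g, ‖U g‖ ^ 2 ∂(stdGaussian (EuclideanSpace ℝ κ)) := fun e => by
    conv_rhs => rw [← stdGaussian_map (signIsometry e)]
    rw [integral_map (signIsometry e).continuous.aemeasurable]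
    exact ((LinearMap.continuous_of_finiteDimensional U).norm.pow 2).aestronglyMeasurable
  have hintsign : ∀ e : κ → ℤˣ, Integrable (fun g => ‖U (signIsometry e g)‖ ^ 2)
      (stdGaussian (EuclideanSpace ℝ κ)) := fun e =>
    integrable_norm_sq_stdGaussian (U.comp (signIsometry e).toLinearEquiv.toLinearMap)
  have hpt : ∀ g : EuclideanSpace ℝ κ, ∑ t, g t ^ 2 * ‖U (EuclideanSpace.single t 1)‖ ^ 2 ≤
      C ^ 2 * ((2 ^ Fintype.card κ : ℝ)⁻¹ * ∑ e : κ → ℤˣ, ‖U (signIsometry e g)‖ ^ 2) := fun g => by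
    have h1 := hE.sum_sq_le fun t => g t • U (EuclideanSpace.single t 1)
    have h2 : ∀ e : κ → ℤˣ, ∑ t, sgnR (e t) • g t • U (EuclideanSpace.single t 1)
        = U (signIsometry e g) := fun e => by
      conv_rhs => rw [euclidean_sum_single (signIsometry e g), map_sum]
      refine Finset.sum_congr rfl fun t _ => ?_
      rw [map_smul, smul_smul, signIsometry_apply]
    simp_rw [h2, norm_smul, mul_pow, Real.norm_eq_abs, sq_abs] at h1
    exact h1
  have hg : ∀ t, Integrable (fun g : EuclideanSpace ℝ κ => g t ^ 2)
      (stdGaussian (EuclideanSpace ℝ κ)) := fun t => by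
    simpa using integrable_norm_sq_stdGaussian (EuclideanSpace.proj (𝕜 := ℝ) t).toLinearMap
  have hg1 : ∀ t, ∫ g : EuclideanSpace ℝ κ, g t ^ 2 ∂(stdGaussian (EuclideanSpace ℝ κ)) = 1 :=
    fun t => by
      simpa [EuclideanSpace.inner_single_left] using
        integral_inner_sq_stdGaussian (EuclideanSpace.single t (1 : ℝ))
  calc ∑ t, ‖U (EuclideanSpace.single t 1)‖ ^ 2
      = ∫ g, ∑ t, g t ^ 2 * ‖U (EuclideanSpace.single t 1)‖ ^ 2
          ∂(stdGaussian (EuclideanSpace ℝ κ)) := by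
        rw [integral_finsetSum _ fun t _ => (hg t).mul_const _]
        simp_rw [integral_mul_const, hg1, one_mul]
    _ ≤ ∫ g, C ^ 2 * ((2 ^ Fintype.card κ : ℝ)⁻¹ * ∑ e : κ → ℤˣ, ‖U (signIsometry e g)‖ ^ 2)
          ∂(stdGaussian (EuclideanSpace ℝ κ)) := by
        refine integral_mono (integrable_finsetSum _ fun t _ => (hg t).mul_const _) ?_ hpt
        exact ((integrable_finsetSum _ fun e _ => hintsign e).const_mul _).const_mul _
    _ = _ := by
        rw [integral_const_mul, integral_const_mul, integral_finsetSum _ fun e _ => hintsign e]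
        simp_rw [hsign]
        simp only [Finset.sum_const, Finset.card_univ, nsmul_eq_mul, card_signs]
        rw [inv_mul_cancel_left₀ hp.ne']

/-- The analysis operator of a finite family of vectors. -/
def analysisOp (r : κ → EuclideanSpace ℝ (Fin m)) :
    EuclideanSpace ℝ (Fin m) →L[ℝ] EuclideanSpace ℝ κ :=
  LinearMap.toContinuousLinearMap
    ((WithLp.linearEquiv 2 ℝ (κ → ℝ)).symm.toLinearMap.comp
      (LinearMap.pi fun t => (innerSL ℝ (r t)).toLinearMap))

theorem analysisOp_apply (r : κ → EuclideanSpace ℝ (Fin m)) (h : EuclideanSpace ℝ (Fin m)) (t : κ) :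
    analysisOp r h t = inner ℝ (r t) h := rfl

theorem norm_analysisOp_sq (r : κ → EuclideanSpace ℝ (Fin m)) (h : EuclideanSpace ℝ (Fin m)) :
    ‖analysisOp r h‖ ^ 2 = ∑ t, inner ℝ (r t) h ^ 2 := by
  rw [EuclideanSpace.norm_sq_eq]
  simp [analysisOp_apply]

theorem analysisOp_adjoint_single [DecidableEq κ] (r : κ → EuclideanSpace ℝ (Fin m)) (t : κ) :
    (analysisOp r).adjoint (EuclideanSpace.single t 1) = r t := by
  refine ext_inner_right ℝ fun h => ?_
  rw [ContinuousLinearMap.adjoint_inner_left, EuclideanSpace.inner_single_left]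
  simp [analysisOp_apply]

/-- A tight frame is the image of an orthonormal basis under the adjoint of an isometry, and this
adjoint carries the Gaussian law to the Gaussian law; the case of coordinates therefore suffices. -/
theorem HasCotype2With.sum_sq_le_integral_of_eq {C : ℝ≥0} (hE : HasCotype2With C E)
    (r : κ → EuclideanSpace ℝ (Fin m)) (hr : ∀ h, ∑ t, inner ℝ (r t) h ^ 2 = ‖h‖ ^ 2)
    (S : EuclideanSpace ℝ (Fin m) →ₗ[ℝ] E) :
    ∑ t, ‖S (r t)‖ ^ 2 ≤ C ^ 2 * ∫ g, ‖S g‖ ^ 2 ∂(stdGaussian (EuclideanSpace ℝ (Fin m))) := by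
  classical
  have h1 := hE.sum_sq_le_integral_coord (S.comp (analysisOp r).adjoint.toLinearMap)
  have hA : ∀ h, ‖analysisOp r h‖ = ‖h‖ := fun h => by
    rw [← sq_eq_sq₀ (norm_nonneg _) (norm_nonneg _), norm_analysisOp_sq, hr]
  rw [← stdGaussian_map_adjoint _ hA, integral_map (by fun_prop)]
  · simpa [analysisOp_adjoint_single] using h1
  · exact ((LinearMap.continuous_of_finiteDimensional S).norm.pow 2).aestronglyMeasurable

theorem dotProduct_transpose_mul_self_mulVec {κ : Type*} [Fintype κ] {m : ℕ}
    (B : Matrix κ (Fin m) ℝ) (x : Fin m → ℝ) :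
    x ⬝ᵥ ((B.transpose * B).mulVec x) =
      ∑ t, inner ℝ (WithLp.toLp 2 (B t) : EuclideanSpace ℝ (Fin m)) (WithLp.toLp 2 x) ^ 2 := by
  rw [← Matrix.mulVec_mulVec, Matrix.dotProduct_mulVec, Matrix.vecMul_transpose]
  simp [dotProduct, sq, Matrix.mulVec, PiLp.inner_apply, mul_comm]

open scoped MatrixOrder Matrix.Norms.L2Operator in
/-- A family dominated by the identity can be completed to a tight frame. -/
theorem exists_frame_completion (r : κ → EuclideanSpace ℝ (Fin m))
    (hr : ∀ h, ∑ t, inner ℝ (r t) h ^ 2 ≤ ‖h‖ ^ 2) :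
    ∃ q : Fin m → EuclideanSpace ℝ (Fin m),
      ∀ h, ∑ t, inner ℝ (r t) h ^ 2 + ∑ j, inner ℝ (q j) h ^ 2 = ‖h‖ ^ 2 := by
  let R : Matrix κ (Fin m) ℝ := Matrix.of fun t j => r t j
  let Q : Matrix (Fin m) (Fin m) ℝ := 1 - R.transpose * R
  have hRr : ∀ t, (WithLp.toLp 2 (R t) : EuclideanSpace ℝ (Fin m)) = r t := fun t => by
    ext j; simp [R]
  have hnorm : ∀ x : Fin m → ℝ, x ⬝ᵥ x = ‖(WithLp.toLp 2 x : EuclideanSpace ℝ (Fin m))‖ ^ 2 :=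
    fun x => by rw [EuclideanSpace.norm_sq_eq]; simp [dotProduct, sq]
  have hQ : Q.PosSemidef := by
    refine Matrix.PosSemidef.of_dotProduct_mulVec_nonneg ?_ fun x => ?_
    · rw [Matrix.IsHermitian, Matrix.conjTranspose_eq_transpose_of_trivial]
      simp [Q, Matrix.transpose_sub, Matrix.transpose_mul]
    · have := hr (WithLp.toLp 2 x)
      simp only [Q, star_trivial, Matrix.sub_mulVec, Matrix.one_mulVec, dotProduct_sub,
        dotProduct_transpose_mul_self_mulVec, hRr, hnorm]
      linarith
  -- The defect `1 - RᵀR` is positive semidefinite, hence of the form `BᵀB`; the rows of `B` are the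
  -- missing frame vectors.
  obtain ⟨B, hB⟩ := CStarAlgebra.nonneg_iff_eq_star_mul_self.1 hQ.nonneg
  refine ⟨fun j => WithLp.toLp 2 (B j), fun h => ?_⟩
  obtain ⟨x, rfl⟩ : ∃ x : Fin m → ℝ, h = WithLp.toLp 2 x := ⟨_, rfl⟩
  rw [Matrix.star_eq_conjTranspose, Matrix.conjTranspose_eq_transpose_of_trivial] at hB
  have h1 := dotProduct_transpose_mul_self_mulVec B x
  rw [← hB] at h1
  simp only [Q, Matrix.sub_mulVec, Matrix.one_mulVec, dotProduct_sub,
        dotProduct_transpose_mul_self_mulVec, hRr, hnorm] at h1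
  linarith

/-- In a space of cotype 2 the Gaussian average of an operator on a Euclidean space dominates its
2-summing norm. -/
theorem HasCotype2With.sum_sq_le_integral {C : ℝ≥0} (hE : HasCotype2With C E)
    (r : κ → EuclideanSpace ℝ (Fin m)) {c : ℝ} (hc : 0 ≤ c)
    (hr : ∀ h, ∑ t, inner ℝ (r t) h ^ 2 ≤ c ^ 2 * ‖h‖ ^ 2)
    (S : EuclideanSpace ℝ (Fin m) →ₗ[ℝ] E) :
    ∑ t, ‖S (r t)‖ ^ 2
      ≤ c ^ 2 * (C ^ 2 * ∫ g, ‖S g‖ ^ 2 ∂(stdGaussian (EuclideanSpace ℝ (Fin m)))) := by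
  have hI : 0 ≤ ∫ g, ‖S g‖ ^ 2 ∂(stdGaussian (EuclideanSpace ℝ (Fin m))) :=
    integral_nonneg fun _ => by positivity
  rcases hc.eq_or_lt with rfl | hc
  · have : ∀ t, r t = 0 := fun t => by
      have h1 := hr (r t)
      have h2 : inner ℝ (r t) (r t) ^ 2 ≤ ∑ s, inner ℝ (r s) (r t) ^ 2 :=
        Finset.single_le_sum (f := fun s => inner ℝ (r s) (r t) ^ 2)
          (fun _ _ => sq_nonneg _) (Finset.mem_univ t)
      have h3 : inner ℝ (r t) (r t) ^ 2 = 0 := le_antisymm (by simpa using h2.trans h1)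
        (sq_nonneg _)
      exact inner_self_eq_zero.1 (pow_eq_zero_iff two_ne_zero |>.1 h3)
    simp [this]
  obtain ⟨q, hq⟩ := exists_frame_completion (fun t => c⁻¹ • r t) fun h => by
    simp_rw [real_inner_smul_left, mul_pow, ← Finset.mul_sum]
    rw [inv_pow, inv_mul_le_iff₀ (by positivity)]
    exact hr h
  have := hE.sum_sq_le_integral_of_eq (Sum.elim (fun t => c⁻¹ • r t) q)
    (fun h => by simpa [Fintype.sum_sum_type] using hq h) S
  simp only [Fintype.sum_sum_type, Sum.elim_inl, Sum.elim_inr, map_smul, norm_smul, mul_pow,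
    ← Finset.mul_sum] at this
  have h0 : 0 ≤ ∑ j, ‖S (q j)‖ ^ 2 := Finset.sum_nonneg fun _ _ => by positivity
  rw [Real.norm_eq_abs, sq_abs, inv_pow] at this
  rw [← inv_mul_le_iff₀ (by positivity)]
  linarith

end Gaussian

/-! ### Pietsch domination and factorization. -/

section Pietsch

variable {E : Type*} [NormedAddCommGroup E] [NormedSpace ℝ E]
variable {H : Type*} [NormedAddCommGroup H] [NormedSpace ℝ H]

/-- A real form of `π₁(T) ≤ p`, with the weak `ℓ₁`-norm computed from signs. -/
def SignSumming (p : ℝ) (T : E →ₗ[ℝ] H) : Prop :=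
  ∀ (n : ℕ) (x : Fin n → E) (W : ℝ), (∀ e : Fin n → ℤˣ, ‖∑ i, sgnR (e i) • x i‖ ≤ W) →
    ∑ i, ‖T (x i)‖ ≤ p * W

/-- Pietsch's domination theorem, with a finitely supported measure. Finite dimension makes the dual
ball compact, so a finite `1/2`-net replaces it and the finite minimax principle is enough. The net
norms vectors up to the factor `2` in the conclusion. -/
theorem SignSumming.exists_domination [FiniteDimensional ℝ E] {p : ℝ} (hp : 0 ≤ p)
    {T : E →ₗ[ℝ] H} (hT : SignSumming p T) :
    ∃ (M : ℕ) (f : Fin M → StrongDual ℝ E) (μ : Fin M → ℝ), (∀ t, ‖f t‖ ≤ 1) ∧ (∀ t, 0 ≤ μ t) ∧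
      ∑ t, μ t = 1 ∧ ∀ x, ‖T x‖ ≤ 2 * p * ∑ t, μ t * |f t x| := by
  obtain ⟨s, hs, hsf, hcov⟩ := (isCompact_closedBall (0 : StrongDual ℝ E) 1).finite_cover_balls
    (e := 1 / 2) (by norm_num)
  have : Finite s := hsf
  have : Fintype s := Fintype.ofFinite s
  let φ := Fintype.equivFin s
  let f : Fin (Fintype.card s) → StrongDual ℝ E := fun t => (φ.symm t : StrongDual ℝ E)
  have hf : ∀ t, ‖f t‖ ≤ 1 := fun t => by simpa using hs (φ.symm t).2
  have hnet : ∀ g : StrongDual ℝ E, ‖g‖ ≤ 1 → ∃ t, ‖g - f t‖ ≤ 1 / 2 := fun g hg => by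
    obtain ⟨y, hy, hgy⟩ := Set.mem_iUnion₂.1 (hcov (by simpa using hg))
    refine ⟨φ ⟨y, hy⟩, ?_⟩
    simpa [f, ← dist_eq_norm] using (Metric.mem_ball.1 hgy).le
  have : Nonempty (Fin (Fintype.card s)) := (hnet 0 (by simp)).nonempty
  let A : Set (Fin (Fintype.card s) → ℝ) := {a | ∃ (n : ℕ) (x : Fin n → E),
    a = fun t => 2 * p * ∑ i, |f t (x i)| - ∑ i, ‖T (x i)‖}
  have hA : Convex ℝ A := by
    rintro _ ⟨n, x, rfl⟩ _ ⟨n', x', rfl⟩ a b ha hb -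
    -- Here the functions are homogeneous of degree one in the vectors, so the weights themselves
    -- serve as scalars.
    refine ⟨n + n', Fin.append (fun i => a • x i) (fun i => b • x' i), ?_⟩
    ext t
    simp only [Fin.sum_univ_add, Fin.append_left, Fin.append_right, map_smul, norm_smul,
      smul_eq_mul, abs_mul, Real.norm_eq_abs, abs_of_nonneg ha, abs_of_nonneg hb,
      ← Finset.mul_sum, Pi.add_apply, Pi.smul_apply]
    ring
  have hne : ∀ a ∈ A, ∃ t, 0 ≤ a t := by
    rintro _ ⟨n, x, rfl⟩
    obtain ⟨e, -, he⟩ := Finset.exists_max_image Finset.univ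
      (fun e : Fin n → ℤˣ => ‖∑ i, sgnR (e i) • x i‖) ⟨1, Finset.mem_univ _⟩
    set y := ∑ i, sgnR (e i) • x i with hy
    have h1 := hT n x ‖y‖ fun e' => he e' (Finset.mem_univ _)
    obtain ⟨g, hg1, hg⟩ := exists_dual_vector'' ℝ y
    obtain ⟨t, ht⟩ := hnet g hg1
    refine ⟨t, ?_⟩
    have h2 : ‖y‖ ≤ 2 * |f t y| := by
      have h3 : |(g - f t) y| ≤ 1 / 2 * ‖y‖ :=
        ((g - f t).le_opNorm y).trans (by gcongr)
      have h4 : g y = ‖y‖ := by simpa using hg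
      simp only [sub_apply, h4] at h3
      have := abs_le.1 h3
      have := le_abs_self (f t y)
      linarith
    have h5 : |f t y| ≤ ∑ i, |f t (x i)| := by
      rw [hy, map_sum]
      refine (Finset.abs_sum_le_sum_abs _ _).trans_eq ?_
      simp [abs_mul, abs_sgnR]
    have h6 : p * ‖y‖ ≤ p * (2 * ∑ i, |f t (x i)|) := by gcongr; linarith
    simp only
    linarith
  obtain ⟨μ, hμ0, hμ1, hμ⟩ := exists_probability_of_convex A hA hne
  refine ⟨_, f, μ, hf, hμ0, hμ1, fun x => ?_⟩
  have := hμ _ ⟨1, fun _ => x, rfl⟩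
  simp only [Fin.sum_univ_one, mul_sub, Finset.sum_sub_distrib, ← Finset.sum_mul, hμ1] at this
  rw [Finset.mul_sum]
  have h2 : ∑ t, μ t * (2 * p * |f t x|) = ∑ t, 2 * p * (μ t * |f t x|) :=
    Finset.sum_congr rfl fun i _ => by ring
  linarith

/-- An operator dominated by a Hilbert space valued operator factors through it. -/
theorem exists_factorization {V : Type*} [NormedAddCommGroup V] [InnerProductSpace ℝ V]
    [FiniteDimensional ℝ V] {c : ℝ} (hc : 0 ≤ c) (J : E →ₗ[ℝ] V) (T : E →ₗ[ℝ] H)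
    (h : ∀ x, ‖T x‖ ≤ c * ‖J x‖) :
    ∃ R : V →ₗ[ℝ] H, (∀ x, R (J x) = T x) ∧ ∀ v, ‖R v‖ ≤ c * ‖v‖ := by
  have hker : LinearMap.ker J ≤ LinearMap.ker T := fun x hx => by
    have := h x
    rw [LinearMap.mem_ker.1 hx] at this
    simpa using this
  let R₀ : LinearMap.range J →ₗ[ℝ] H :=
    ((LinearMap.ker J).liftQ T hker).comp J.quotKerEquivRange.symm.toLinearMap
  have hR₀ : ∀ x, R₀ ⟨J x, LinearMap.mem_range_self J x⟩ = T x := fun x => by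
    simp [R₀, LinearMap.quotKerEquivRange_symm_apply_image J x (LinearMap.mem_range_self J x)]
  have hR₀n : ∀ y, ‖R₀ y‖ ≤ c * ‖y‖ := by
    rintro ⟨_, x, rfl⟩
    rw [hR₀]; exact h x
  -- Orthogonal projection onto the range of `J` extends `R₀` without increasing its norm.
  refine ⟨R₀.comp (LinearMap.range J).orthogonalProjectionOnto.toLinearMap, fun x => ?_, fun v => ?_⟩
  · have := (LinearMap.range J).orthogonalProjectionOnto_mem_subspace_eq_self
      ⟨J x, LinearMap.mem_range_self J x⟩
    simp only [LinearMap.comp_apply, ContinuousLinearMap.coe_coe, this, hR₀]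
  · refine (hR₀n _).trans ?_
    gcongr
    exact (LinearMap.range J).norm_orthogonalProjectionOnto_apply_le v

end Pietsch

/-! ### Trace duality and the estimate for finitely many summands of cotype 2. -/

section CotypeCore

/-- Trace duality between 1-summing operators on a space of cotype 2 and Gaussian averages. -/
theorem HasCotype2With.trace_le {E : Type*} [NormedAddCommGroup E] [NormedSpace ℝ E] {C : ℝ≥0}
    (hE : HasCotype2With C E) {m : ℕ} {p : ℝ} (hp : 0 ≤ p)
    {T : E →ₗ[ℝ] EuclideanSpace ℝ (Fin m)} (hT : SignSumming p T)
    (S : EuclideanSpace ℝ (Fin m) →ₗ[ℝ] E) :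
    ∑ j, T (S (EuclideanSpace.single j 1)) j
      ≤ 2 * p * (C * Real.sqrt (∫ g, ‖S g‖ ^ 2 ∂(stdGaussian (EuclideanSpace ℝ (Fin m))))) := by
  set I := ∫ g, ‖S g‖ ^ 2 ∂(stdGaussian (EuclideanSpace ℝ (Fin m)))
  -- Only the range of `S` matters for the trace, and it is finite-dimensional as Pietsch domination
  -- requires.
  let T' : LinearMap.range S →ₗ[ℝ] EuclideanSpace ℝ (Fin m) := T.comp (LinearMap.range S).subtype
  have hT' : SignSumming p T' := fun n x W hW => hT n (fun i => x i) W fun e => by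
    simpa using hW e
  obtain ⟨M, f, μ, hf, hμ0, hμ1, hdom⟩ := hT'.exists_domination hp
  let J : LinearMap.range S →ₗ[ℝ] EuclideanSpace ℝ (Fin M) :=
    (WithLp.linearEquiv 2 ℝ (Fin M → ℝ)).symm.toLinearMap.comp
      (LinearMap.pi fun t => Real.sqrt (μ t) • (f t).toLinearMap)
  have hJ : ∀ x t, J x t = Real.sqrt (μ t) * f t x := fun x t => rfl
  have hTJ : ∀ x, ‖T' x‖ ≤ 2 * p * ‖J x‖ := fun x => by
    refine (hdom x).trans ?_
    gcongr
    rw [EuclideanSpace.norm_eq]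
    refine Real.le_sqrt_of_sq_le ?_
    calc (∑ t, μ t * |f t x|) ^ 2
        = (∑ t, Real.sqrt (μ t) * (Real.sqrt (μ t) * |f t x|)) ^ 2 := by
          congr 1
          exact Finset.sum_congr rfl fun t _ => by rw [← mul_assoc, Real.mul_self_sqrt (hμ0 t)]
      _ ≤ (∑ t, Real.sqrt (μ t) ^ 2) * ∑ t, (Real.sqrt (μ t) * |f t x|) ^ 2 :=
          Finset.sum_mul_sq_le_sq_mul_sq _ _ _
      _ = ∑ t, ‖J x t‖ ^ 2 := by
          simp_rw [fun t => Real.sq_sqrt (hμ0 t), hμ1, one_mul, hJ, Real.norm_eq_abs, sq_abs,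
            mul_pow, sq_abs]
  obtain ⟨R, hRJ, hRn⟩ := exists_factorization (by positivity) J T' hTJ
  set r : Fin M → EuclideanSpace ℝ (Fin m) := fun t => R (EuclideanSpace.single t 1) with hr
  have hRr : ∀ v : EuclideanSpace ℝ (Fin M), R v = ∑ t, v t • r t := fun v => by
    conv_lhs => rw [euclidean_sum_single v, map_sum]
    simp [hr]
  -- The analysis operator of the `r t` is the adjoint of `R`, so its norm is at most `2 p` as well.
  have hframe : ∀ h, ∑ t, inner ℝ (r t) h ^ 2 ≤ (2 * p) ^ 2 * ‖h‖ ^ 2 := fun h => by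
    rw [← mul_pow, ← norm_analysisOp_sq]
    refine pow_le_pow_left₀ (norm_nonneg _) ?_ 2
    set v := analysisOp r h
    have h1 : ‖v‖ ^ 2 = inner ℝ (R v) h := by
      rw [norm_analysisOp_sq, hRr, sum_inner]
      exact Finset.sum_congr rfl fun t _ => by
        rw [real_inner_smul_left, sq]; rfl
    have h2 : ‖v‖ ^ 2 ≤ (2 * p * ‖v‖) * ‖h‖ := by
      rw [h1]
      exact (real_inner_le_norm _ _).trans (by gcongr; exact hRn v)
    rcases (norm_nonneg v).eq_or_lt with h0 | h0
    · rw [← h0]; positivity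
    · nlinarith
  have hsum := hE.sum_sq_le_integral r (by positivity) hframe S
  -- On the range of `S`, `T = R J`; cyclicity of the trace moves `R` to the right, `tr (R J S) = tr
  -- (J S R)`.
  calc ∑ j, T (S (EuclideanSpace.single j 1)) j
      = ∑ t, J ⟨S (r t), LinearMap.mem_range_self S _⟩ t := by
        have h1 : ∀ j, T (S (EuclideanSpace.single j 1)) =
            ∑ t, J ⟨S (EuclideanSpace.single j 1), LinearMap.mem_range_self S _⟩ t • r t :=
          fun j => by rw [← hRr, hRJ]; rfl
        have h2 : ∀ t, J ⟨S (r t), LinearMap.mem_range_self S _⟩ =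
            ∑ j, r t j • J ⟨S (EuclideanSpace.single j 1), LinearMap.mem_range_self S _⟩ :=
          fun t => by
            simp_rw [← map_smul, ← map_sum]
            congr 1
            ext
            conv_lhs => rw [euclidean_sum_single (r t)]
            simp
        simp_rw [h1, h2]
        simp only [WithLp.ofLp_sum, WithLp.ofLp_smul, Finset.sum_apply, Pi.smul_apply, smul_eq_mul]
        rw [Finset.sum_comm]
        exact Finset.sum_congr rfl fun t _ => Finset.sum_congr rfl fun j _ => mul_comm _ _
    _ ≤ ∑ t, Real.sqrt (μ t) * ‖S (r t)‖ := by
        gcongr with t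
        rw [hJ]
        gcongr
        refine (le_abs_self _).trans (((f t).le_opNorm _).trans ?_)
        exact mul_le_of_le_one_left (norm_nonneg _) (hf t)
    _ ≤ Real.sqrt (∑ t, Real.sqrt (μ t) ^ 2) * Real.sqrt (∑ t, ‖S (r t)‖ ^ 2) :=
        Real.sum_mul_le_sqrt_mul_sqrt _ _ _
    _ ≤ Real.sqrt ((2 * p) ^ 2 * (C ^ 2 * I)) := by
        simp_rw [fun t => Real.sq_sqrt (hμ0 t), hμ1, Real.sqrt_one, one_mul]
        exact Real.sqrt_le_sqrt hsum
    _ = 2 * p * (C * Real.sqrt I) := by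
        rw [Real.sqrt_mul (by positivity), Real.sqrt_mul (by positivity),
          Real.sqrt_sq (by positivity), Real.sqrt_sq (NNReal.coe_nonneg C)]

theorem HasCotype2With.piLp {N : ℕ} {X : Fin N → Type*} [∀ n, NormedAddCommGroup (X n)]
    {C : ℝ≥0} (hX : ∀ n, HasCotype2With C (X n)) :
    HasCotype2With C (PiLp 2 X) := fun k x => by
  have hn : ∀ y : PiLp 2 X, ‖y‖ ^ 2 = ∑ n, ‖y n‖ ^ 2 := fun y => PiLp.norm_sq_eq_of_L2 X y
  have hap : ∀ (y : Fin k → PiLp 2 X) n, (∑ i, y i) n = ∑ i, y i n := fun y n => by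
    simp
  have h1 : ∀ n, ∑ i, ‖x i n‖ ^ 2 ≤
      C ^ 2 * ((2 ^ k : ℝ)⁻¹ * ∑ e : Fin k → ℤˣ, ‖∑ i, e i • x i n‖ ^ 2) := fun n => by
    have h := hX n k fun i => x i n
    have h4 := pow_le_pow_left₀ (Real.sqrt_nonneg _) h 2
    rwa [mul_pow, Real.sq_sqrt (by positivity), Real.sq_sqrt (by positivity)] at h4
  have hs : ∀ (e : ℤˣ) (y : PiLp 2 X) n, (e • y) n = e • y n := fun e y n => by
    rcases Int.units_eq_one_or e with rfl | rfl <;> simp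
  refine Real.sqrt_le_iff.2 ⟨by positivity, ?_⟩
  rw [mul_pow, Real.sq_sqrt (by positivity)]
  simp_rw [hn, hap, hs]
  calc ∑ i, ∑ n, ‖x i n‖ ^ 2 = ∑ n, ∑ i, ‖x i n‖ ^ 2 := Finset.sum_comm
    _ ≤ ∑ n, C ^ 2 * ((2 ^ k : ℝ)⁻¹ * ∑ e : Fin k → ℤˣ, ‖∑ i, e i • x i n‖ ^ 2) :=
        Finset.sum_le_sum fun n _ => h1 n
    _ = _ := by rw [← Finset.mul_sum, ← Finset.mul_sum, Finset.sum_comm]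

/-- The constant in the estimate for spaces of cotype 2. -/
def cotypeConst (C : ℝ≥0) : ℝ := 2 * C * (C * (2 * (4 * C + 1)))

theorem cotypeConst_nonneg (C : ℝ≥0) : 0 ≤ cotypeConst C := by unfold cotypeConst; positivity

/-- Weights are found for the whole `ℓ₂`-sum, whereas the trace estimate is used on each summand;
Cauchy-Schwarz over `n` joins the two. -/
theorem sum_norm_le_of_cotype {N : ℕ} {X : Fin N → Type*} [∀ n, NormedAddCommGroup (X n)]
    [∀ n, NormedSpace ℝ (X n)] {C : ℝ≥0} (hX : ∀ n, HasCotype2With C (X n)) {m : ℕ}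
    (T : ∀ n, X n →ₗ[ℝ] EuclideanSpace ℝ (Fin m)) (p : Fin N → ℝ) (hp : ∀ n, 0 ≤ p n)
    (hT : ∀ n, SignSumming (p n) (T n)) {k : ℕ} (x : Fin k → ∀ n, X n) {W : ℝ} (hW : 0 ≤ W)
    (hx : ∀ τ : Fin k → ℝ, (∀ i, |τ i| ≤ 1) → ∑ n, ‖∑ i, τ i • x i n‖ ^ 2 ≤ W ^ 2) :
    ∑ i, ‖∑ n, T n (x i n)‖ ≤ cotypeConst C * Real.sqrt (∑ n, p n ^ 2) * W := by
  rcases Nat.eq_zero_or_pos k with rfl | hk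
  · simpa using mul_nonneg (mul_nonneg (cotypeConst_nonneg C) (Real.sqrt_nonneg _)) hW
  have : NeZero k := ⟨hk.ne'⟩
  let x' : Fin k → PiLp 2 X := fun i => WithLp.toLp 2 (x i)
  have hn : ∀ y : PiLp 2 X, ‖y‖ ^ 2 = ∑ n, ‖y n‖ ^ 2 := fun y => PiLp.norm_sq_eq_of_L2 X y
  have hap : ∀ (a : Fin k → ℝ) n, (∑ i, a i • x' i) n = ∑ i, a i • x i n := fun a n => by
    simp [x']
  obtain ⟨μ, hμ0, hμ1, hμ⟩ := (HasCotype2With.piLp hX).exists_weights x' (W := W) fun τ hτ => by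
    refine (sq_le_sq₀ (norm_nonneg _) hW).1 ?_
    rw [hn]; simp_rw [hap]; exact hx τ hτ
  set B : ℝ := C ^ 2 * (4 * (4 * C + 1) ^ 2 * W ^ 2) with hB
  simp_rw [hn, hap] at hμ
  let v : Fin k → EuclideanSpace ℝ (Fin m) := fun i => ∑ n, T n (x i n)
  -- Norming vectors; since `0⁻¹ = 0`, a vanishing `v i` gets `h i = 0`.
  let h : Fin k → EuclideanSpace ℝ (Fin m) := fun i => ‖v i‖⁻¹ • v i
  have hh1 : ∀ i, ‖h i‖ ≤ 1 := fun i => by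
    rw [norm_smul, norm_inv, norm_norm]; exact inv_mul_le_one
  have hh2 : ∀ i, inner ℝ (h i) (v i) = ‖v i‖ := fun i => by
    rw [real_inner_smul_left, real_inner_self_eq_norm_sq]
    rcases eq_or_ne ‖v i‖ 0 with h0 | h0
    · simp [h0]
    · field_simp
  let S : ∀ n, EuclideanSpace ℝ (Fin m) →ₗ[ℝ] X n := fun n =>
    ∑ i, (innerSL ℝ (h i)).toLinearMap.smulRight (x i n)
  have hS : ∀ n g, S n g = ∑ i, inner ℝ (h i) g • x i n := fun n g => by
    simp [S, LinearMap.sum_apply]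
  set I : Fin N → ℝ := fun n => ∫ g, ‖S n g‖ ^ 2 ∂(stdGaussian (EuclideanSpace ℝ (Fin m))) with hI
  have hI0 : ∀ n, 0 ≤ I n := fun n => integral_nonneg fun _ => by positivity
  -- The domination is integrated with the Gaussian coefficients `⟨h i, g⟩`, whose variances `‖h
  -- i‖²` are at most one, against weights of total mass one.
  have hIsum : ∑ n, I n ≤ B := by
    have hint : ∀ i, Integrable (fun g => inner ℝ (h i) g ^ 2)
        (stdGaussian (EuclideanSpace ℝ (Fin m))) := fun i => by
      simpa using integrable_norm_sq_stdGaussian (innerSL ℝ (h i)).toLinearMap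
    calc ∑ n, I n = ∫ g, ∑ n, ‖S n g‖ ^ 2 ∂(stdGaussian (EuclideanSpace ℝ (Fin m))) :=
          (integral_finsetSum _ fun n _ => integrable_norm_sq_stdGaussian (S n)).symm
      _ ≤ ∫ g, B * ∑ i, μ i * inner ℝ (h i) g ^ 2 ∂(stdGaussian (EuclideanSpace ℝ (Fin m))) := by
          refine integral_mono
            (integrable_finsetSum _ fun n _ => integrable_norm_sq_stdGaussian (S n))
            ((integrable_finsetSum _ fun i _ => (hint i).const_mul _).const_mul _) fun g => ?_
          simp_rw [hS]
          exact hμ fun i => inner ℝ (h i) g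
      _ = B * ∑ i, μ i * ‖h i‖ ^ 2 := by
          rw [integral_const_mul, integral_finsetSum _ fun i _ => (hint i).const_mul _]
          simp_rw [integral_const_mul, integral_inner_sq_stdGaussian]
      _ ≤ B * ∑ i, μ i * 1 := by
          gcongr with i
          · exact hμ0 i
          · exact pow_le_one₀ (norm_nonneg _) (hh1 i)
      _ = B := by simp [hμ1]
  calc ∑ i, ‖∑ n, T n (x i n)‖ = ∑ i, inner ℝ (h i) (v i) := by simp_rw [hh2]; rfl
    _ = ∑ n, ∑ j, T n (S n (EuclideanSpace.single j 1)) j := by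
        simp_rw [v, inner_sum]
        rw [Finset.sum_comm]
        refine Finset.sum_congr rfl fun n _ => ?_
        simp_rw [hS, map_sum, map_smul, WithLp.ofLp_sum, Finset.sum_apply]
        rw [Finset.sum_comm]
        refine Finset.sum_congr rfl fun i _ => ?_
        simp [PiLp.inner_apply, mul_comm]
    _ ≤ ∑ n, 2 * p n * (C * Real.sqrt (I n)) :=
        Finset.sum_le_sum fun n _ => (hX n).trace_le (hp n) (hT n) (S n)
    _ = 2 * C * ∑ n, p n * Real.sqrt (I n) := by
        rw [Finset.mul_sum]; exact Finset.sum_congr rfl fun n _ => by ring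
    _ ≤ 2 * C * (Real.sqrt (∑ n, p n ^ 2) * Real.sqrt (∑ n, Real.sqrt (I n) ^ 2)) := by
        gcongr; exact Real.sum_mul_le_sqrt_mul_sqrt _ _ _
    _ ≤ 2 * C * (Real.sqrt (∑ n, p n ^ 2) * Real.sqrt B) := by
        simp_rw [fun n => Real.sq_sqrt (hI0 n)]
        gcongr
    _ = cotypeConst C * Real.sqrt (∑ n, p n ^ 2) * W := by
        have : B = (C * (2 * (4 * C + 1)) * W) ^ 2 := by rw [hB]; ring
        rw [this, Real.sqrt_sq (by positivity), cotypeConst]; ring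

end CotypeCore

/-! ### The weak `ℓ₁`-norm and the 1-summing norm as real numbers. -/

section Weak

variable {𝕜 : Type*} [RCLike 𝕜]
variable {E : Type*} [NormedAddCommGroup E] [NormedSpace 𝕜 E]
variable {F : Type*} [NormedAddCommGroup F] [NormedSpace 𝕜 F]

/-- The weak `ℓ₁`-norm as a real number. -/
def wk (𝕜 : Type*) [RCLike 𝕜] {E : Type*} [NormedAddCommGroup E] [NormedSpace 𝕜 E] {k : ℕ}
    (x : Fin k → E) : ℝ := (weakL1Norm 𝕜 x).toReal

theorem wk_nonneg {k : ℕ} (x : Fin k → E) : 0 ≤ wk 𝕜 x := ENNReal.toReal_nonneg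

theorem weakL1Norm_le {k : ℕ} {x : Fin k → E} {W : ℝ}
    (h : ∀ f : StrongDual 𝕜 E, ‖f‖ ≤ 1 → ∑ i, ‖f (x i)‖ ≤ W) :
    weakL1Norm 𝕜 x ≤ ENNReal.ofReal W := by
  refine iSup₂_le fun f hf => ?_
  simp_rw [← ofReal_norm]
  rw [← ENNReal.ofReal_sum_of_nonneg fun _ _ => norm_nonneg _]
  exact ENNReal.ofReal_le_ofReal (h f hf)

theorem weakL1Norm_ne_top {k : ℕ} (x : Fin k → E) : weakL1Norm 𝕜 x ≠ ∞ := by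
  refine ne_top_of_le_ne_top ENNReal.ofReal_ne_top
    (weakL1Norm_le (W := ∑ i, ‖x i‖) fun f hf => Finset.sum_le_sum fun i _ => ?_)
  exact (f.le_opNorm _).trans (mul_le_of_le_one_left (norm_nonneg _) hf)

theorem wk_le {k : ℕ} {x : Fin k → E} {W : ℝ}
    (h : ∀ f : StrongDual 𝕜 E, ‖f‖ ≤ 1 → ∑ i, ‖f (x i)‖ ≤ W) : wk 𝕜 x ≤ W := by
  have hW : 0 ≤ W := (Finset.sum_nonneg fun _ _ => norm_nonneg _).trans (h 0 (by simp))
  exact ENNReal.toReal_le_of_le_ofReal hW (weakL1Norm_le h)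

theorem sum_norm_le_wk {k : ℕ} (x : Fin k → E) {f : StrongDual 𝕜 E} (hf : ‖f‖ ≤ 1) :
    ∑ i, ‖f (x i)‖ ≤ wk 𝕜 x := by
  have h1 : ∑ i, ‖f (x i)‖ₑ ≤ weakL1Norm 𝕜 x :=
    le_iSup₂ (f := fun (f : StrongDual 𝕜 E) (_ : ‖f‖ ≤ 1) => ∑ i, ‖f (x i)‖ₑ) f hf
  have h2 := ENNReal.toReal_mono (weakL1Norm_ne_top x) h1
  rwa [ENNReal.toReal_sum fun i _ => enorm_ne_top] at h2

theorem sum_norm_le_norm_mul_wk {k : ℕ} (x : Fin k → E) (f : StrongDual 𝕜 E) :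
    ∑ i, ‖f (x i)‖ ≤ ‖f‖ * wk 𝕜 x := by
  rcases eq_or_ne f 0 with rfl | hf
  · simp
  have hpos : 0 < ‖f‖ := norm_pos_iff.2 hf
  have h := sum_norm_le_wk x (f := ((‖f‖⁻¹ : ℝ) : 𝕜) • f) (by
    rw [norm_smul]; simp [hpos.ne'])
  simp only [smul_apply, norm_smul, ← Finset.mul_sum] at h
  rw [RCLike.norm_ofReal, abs_of_pos (inv_pos.2 hpos), inv_mul_le_iff₀ hpos] at h
  exact h

theorem norm_sum_smul_le_wk {k : ℕ} (x : Fin k → E) {a : Fin k → 𝕜} (ha : ∀ i, ‖a i‖ ≤ 1) :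
    ‖∑ i, a i • x i‖ ≤ wk 𝕜 x := by
  obtain ⟨g, hg1, hg⟩ := exists_dual_vector'' 𝕜 (∑ i, a i • x i)
  have h1 : ‖∑ i, a i • x i‖ = ‖g (∑ i, a i • x i)‖ := by rw [hg]; simp
  rw [h1, map_sum]
  refine (norm_sum_le _ _).trans (le_trans (Finset.sum_le_sum fun i _ => ?_) (sum_norm_le_wk x hg1))
  rw [map_smul, norm_smul]
  exact mul_le_of_le_one_left (norm_nonneg _) (ha i)

theorem exists_sign_abs (t : ℝ) : ∃ e : ℤˣ, sgnR e * t = |t| := by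
  rcases le_total 0 t with h | h
  · exact ⟨1, by simp [sgnR, abs_of_nonneg h]⟩
  · exact ⟨-1, by simp [sgnR, abs_of_nonpos h]⟩

theorem norm_le_abs_re_add_abs_im (z : 𝕜) : ‖z‖ ≤ |RCLike.re z| + |RCLike.im z| := by
  refine (sq_le_sq₀ (norm_nonneg _) (by positivity)).1 ?_
  rw [RCLike.norm_sq_eq_def]
  nlinarith [sq_abs (RCLike.re z), sq_abs (RCLike.im z),
    mul_nonneg (abs_nonneg (RCLike.re z)) (abs_nonneg (RCLike.im z))]

/-- Real signs see the real and the imaginary parts of the values of a functional separately, which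
costs the factor `2` in the complex case. -/
theorem wk_le_two_mul {k : ℕ} {x : Fin k → E} {W : ℝ}
    (h : ∀ e : Fin k → ℤˣ, ‖∑ i, (sgnR (e i) : 𝕜) • x i‖ ≤ W) : wk 𝕜 x ≤ 2 * W := by
  refine wk_le fun f hf => ?_
  have key : ∀ e : Fin k → ℤˣ, ‖f (∑ i, (sgnR (e i) : 𝕜) • x i)‖ ≤ W := fun e =>
    ((f.le_opNorm _).trans (mul_le_of_le_one_left (norm_nonneg _) hf)).trans (h e)
  have hre : ∑ i, |RCLike.re (f (x i))| ≤ W := by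
    choose e he using fun i => exists_sign_abs (RCLike.re (f (x i)))
    have := (RCLike.re_le_norm _).trans (key e)
    simpa [map_sum, RCLike.re_ofReal_mul, he, -map_intCast] using this
  have him : ∑ i, |RCLike.im (f (x i))| ≤ W := by
    choose e he using fun i => exists_sign_abs (RCLike.im (f (x i)))
    have := (RCLike.im_le_norm _).trans (key e)
    simpa [map_sum, RCLike.im_ofReal_mul, he, -map_intCast] using this
  calc ∑ i, ‖f (x i)‖ ≤ ∑ i, (|RCLike.re (f (x i))| + |RCLike.im (f (x i))|) :=
        Finset.sum_le_sum fun i _ => norm_le_abs_re_add_abs_im _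
    _ ≤ 2 * W := by rw [Finset.sum_add_distrib]; linarith

theorem sum_norm_le_pi1 {T : E →L[𝕜] F} (hT : pi1 T ≠ ∞) {k : ℕ} (x : Fin k → E) :
    ∑ i, ‖T (x i)‖ ≤ (pi1 T).toReal * wk 𝕜 x := by
  have key : ∀ δ : ℝ, 0 < δ → ∑ i, ‖T (x i)‖ ≤ ((pi1 T).toReal + δ) * wk 𝕜 x := fun δ hδ => by
    have h1 : pi1 T < pi1 T + ENNReal.ofReal δ :=
      ENNReal.lt_add_right hT (by simpa using hδ)
    conv_lhs at h1 => rw [pi1]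
    obtain ⟨C, hC⟩ := iInf_lt_iff.1 h1
    obtain ⟨hC1, hC2⟩ := iInf_lt_iff.1 hC
    have h2 := (ENNReal.toReal_mono (ENNReal.mul_ne_top ENNReal.coe_ne_top (weakL1Norm_ne_top x))
      (hC1 k x))
    rw [ENNReal.toReal_sum fun i _ => enorm_ne_top, ENNReal.toReal_mul] at h2
    have h3 := (ENNReal.toReal_mono (by finiteness) hC2.le)
    rw [ENNReal.toReal_add hT ENNReal.ofReal_ne_top, ENNReal.toReal_ofReal hδ.le] at h3
    simp only [toReal_enorm] at h2
    refine h2.trans (mul_le_mul_of_nonneg_right h3 (wk_nonneg x))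
  refine le_of_forall_pos_le_add fun δ hδ => ?_
  have hw : 0 < wk 𝕜 x + 1 := by linarith [wk_nonneg (𝕜 := 𝕜) x]
  refine (key (δ / (wk 𝕜 x + 1)) (by positivity)).trans ?_
  rw [add_mul]
  gcongr
  rw [div_mul_eq_mul_div, div_le_iff₀ hw]
  gcongr; linarith

theorem pi1_le {T : E →L[𝕜] F} {K : ℝ} (hK : 0 ≤ K)
    (h : ∀ (k : ℕ) (x : Fin k → E), ∑ i, ‖T (x i)‖ ≤ K * wk 𝕜 x) : pi1 T ≤ ENNReal.ofReal K := by
  refine iInf₂_le (Real.toNNReal K) fun k x => ?_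
  have h1 := ENNReal.ofReal_le_ofReal (h k x)
  rw [ENNReal.ofReal_sum_of_nonneg fun _ _ => norm_nonneg _, ENNReal.ofReal_mul hK, wk,
    ENNReal.ofReal_toReal (weakL1Norm_ne_top x)] at h1
  simp_rw [ofReal_norm] at h1
  exact h1

theorem wk_map_le {k : ℕ} (A : E →L[𝕜] F) (hA : ‖A‖ ≤ 1) (x : Fin k → E) :
    wk 𝕜 (fun i => A (x i)) ≤ wk 𝕜 x :=
  wk_le fun f hf => sum_norm_le_wk x (f := f.comp A)
    ((f.opNorm_comp_le A).trans (mul_le_one₀ hf (norm_nonneg _) hA))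

theorem pi1_comp_le {G : Type*} [NormedAddCommGroup G] [NormedSpace 𝕜 G] (T : F →L[𝕜] G)
    (A : E →L[𝕜] F) (hA : ‖A‖ ≤ 1) : pi1 (T.comp A) ≤ pi1 T := by
  rcases eq_or_ne (pi1 T) ∞ with h | h
  · rw [h]; exact le_top
  rw [← ENNReal.ofReal_toReal h]
  refine pi1_le ENNReal.toReal_nonneg fun k x => ?_
  refine (sum_norm_le_pi1 h fun i => A (x i)).trans ?_
  gcongr
  exact wk_map_le A hA x

end Weak

/-! ### Passage to real Euclidean spaces. -/

section RealForm

/-- A finite-dimensional inner product space over `𝕜` is isometric to a real Euclidean space. -/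
theorem exists_real_isometry {𝕜 : Type*} [RCLike 𝕜] (V : Type*) [NormedAddCommGroup V]
    [InnerProductSpace 𝕜 V] [FiniteDimensional 𝕜 V] :
    ∃ (m : ℕ) (φ : V →+ EuclideanSpace ℝ (Fin m)), (∀ v, ‖φ v‖ = ‖v‖) ∧
      ∀ (r : ℝ) v, φ ((r : 𝕜) • v) = r • φ v := by
  let _ : InnerProductSpace ℝ V := InnerProductSpace.rclikeToReal 𝕜 V
  have hs : ∀ (r : ℝ) (v : V), (r : 𝕜) • v = r • v := fun r v => rfl
  have : IsScalarTower ℝ 𝕜 V := ⟨fun r c v => by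
    rw [← hs, smul_smul, RCLike.real_smul_eq_coe_mul]⟩
  have : FiniteDimensional ℝ V := Module.Finite.trans 𝕜 V
  let b := stdOrthonormalBasis ℝ V
  refine ⟨_, b.repr.toLinearEquiv.toLinearMap.toAddMonoidHom, fun v => ?_, fun r v => ?_⟩
  · simp
  · rw [hs]; simp

end RealForm

/-! ### Reduction to finitely many summands. -/

section Sum

variable {𝕜 : Type*} [RCLike 𝕜] {X : ℕ → Type*} [∀ n, NormedAddCommGroup (X n)]
  [∀ n, NormedSpace 𝕜 (X n)]

theorem sum_norm_sq_le_norm_sq (y : lp X 2) (s : Finset ℕ) : ∑ n ∈ s, ‖y n‖ ^ 2 ≤ ‖y‖ ^ 2 := by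
  have := lp.sum_rpow_le_norm_rpow (p := 2) (by norm_num) y s
  simpa using this

/-- The restriction of an operator on the `ℓ₂`-sum to a summand. -/
def restr {F : Type*} [NormedAddCommGroup F] [NormedSpace 𝕜 F] (T : lp X 2 →L[𝕜] F) (n : ℕ) :
    X n →L[𝕜] F := T.comp (lp.singleContinuousLinearMap 𝕜 X 2 n)

theorem restr_apply {F : Type*} [NormedAddCommGroup F] [NormedSpace 𝕜 F] (T : lp X 2 →L[𝕜] F)
    (n : ℕ) (x : X n) : restr T n x = T (lp.single 2 n x) := rfl

theorem pi1_restr_le {F : Type*} [NormedAddCommGroup F] [NormedSpace 𝕜 F] (T : lp X 2 →L[𝕜] F)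
    (n : ℕ) : pi1 (restr T n) ≤ pi1 (T.comp (sumProj 𝕜 X n)) := by
  have h : restr T n = (T.comp (sumProj 𝕜 X n)).comp (lp.singleContinuousLinearMap 𝕜 X 2 n) := by
    ext x
    simp only [restr, sumProj, ContinuousLinearMap.comp_apply, lp.singleContinuousLinearMap_apply]
    congr 2
    exact (lp.single_apply_self 2 n x).symm
  rw [h]
  refine pi1_comp_le _ _ (ContinuousLinearMap.opNorm_le_bound _ zero_le_one fun x => ?_)
  rw [lp.singleContinuousLinearMap_apply, lp.norm_single (by norm_num), one_mul]

theorem tendsto_sum_restr {F : Type*} [NormedAddCommGroup F] [NormedSpace 𝕜 F]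
    (T : lp X 2 →L[𝕜] F) (y : lp X 2) :
    Tendsto (fun N => ∑ n ∈ Finset.range N, restr T n (y n)) atTop (𝓝 (T y)) := by
  have h1 := (lp.hasSum_single (p := 2) (by norm_num) y).mapL T
  exact h1.tendsto_sum_nat

/-- Reduction of the square function estimate to finitely many summands. -/
theorem pi1_le_of_finite_sums {F : Type*} [NormedAddCommGroup F] [NormedSpace 𝕜 F]
    {T : lp X 2 →L[𝕜] F} {K : ℝ≥0} (hK : 1 ≤ K)
    (h : (∀ n, pi1 (restr T n) ≠ ∞) → ∀ (N k : ℕ) (x : Fin k → lp X 2),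
      ∑ i, ‖∑ n ∈ Finset.range N, restr T n (x i n)‖
        ≤ K * Real.sqrt (∑ n ∈ Finset.range N, (pi1 (restr T n)).toReal ^ 2) * wk 𝕜 x) :
    pi1 T ≤ K * (∑' n, pi1 (T.comp (sumProj 𝕜 X n)) ^ 2) ^ (1 / 2 : ℝ) := by
  set R := ∑' n, pi1 (T.comp (sumProj 𝕜 X n)) ^ 2 with hR
  -- Used only when the right side is `K * ∞`: as `0 * ∞ = 0`, `K` must not vanish, which is why `1
  -- ≤ K` is assumed.
  have hK0 : (K : ℝ≥0∞) ≠ 0 := by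
    simpa using (zero_lt_one.trans_le hK).ne'
  rcases eq_or_ne R ∞ with hRt | hRt
  · rw [hRt]; simp [hK0]
  have hfin : ∀ n, pi1 (T.comp (sumProj 𝕜 X n)) ^ 2 ≠ ∞ :=
    ENNReal.ne_top_of_tsum_ne_top hRt
  have hle : ∀ n, pi1 (restr T n) ^ 2 ≤ pi1 (T.comp (sumProj 𝕜 X n)) ^ 2 := fun n => by
    gcongr; exact pi1_restr_le T n
  have hfin' : ∀ n, pi1 (restr T n) ≠ ∞ := fun n hn => by
    have := hle n
    rw [hn] at this
    simp at this
    exact hfin n (by simp [this])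
  have hbound : ∀ N, Real.sqrt (∑ n ∈ Finset.range N, (pi1 (restr T n)).toReal ^ 2)
      ≤ Real.sqrt R.toReal := fun N => by
    refine Real.sqrt_le_sqrt ?_
    simp_rw [← ENNReal.toReal_pow]
    rw [← ENNReal.toReal_sum fun n _ => ENNReal.pow_ne_top (hfin' n)]
    refine ENNReal.toReal_mono hRt ?_
    exact (Finset.sum_le_sum fun n _ => hle n).trans (ENNReal.sum_le_tsum _)
  have hmain : pi1 T ≤ ENNReal.ofReal (K * Real.sqrt R.toReal) := by
    refine pi1_le (by positivity) fun k x => ?_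
    have hlim : Tendsto (fun N => ∑ i, ‖∑ n ∈ Finset.range N, restr T n (x i n)‖) atTop
        (𝓝 (∑ i, ‖T (x i)‖)) :=
      tendsto_finsetSum _ fun i _ => (tendsto_sum_restr T (x i)).norm
    refine le_of_tendsto' hlim fun N => (h hfin' N k x).trans ?_
    have := wk_nonneg (𝕜 := 𝕜) x
    exact mul_le_mul_of_nonneg_right (mul_le_mul_of_nonneg_left (hbound N) K.2) this
  refine hmain.trans_eq ?_
  rw [ENNReal.ofReal_mul (by positivity), Real.sqrt_eq_rpow, ENNReal.ofReal_coe_nnreal,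
    ← ENNReal.ofReal_rpow_of_nonneg ENNReal.toReal_nonneg (by norm_num), ENNReal.ofReal_toReal hRt]

end Sum

/-! ### The case of cotype 2. -/

section CotypeCase

variable {𝕜 : Type*} [RCLike 𝕜] {X : ℕ → Type*} [∀ n, NormedAddCommGroup (X n)]
  [∀ n, NormedSpace 𝕜 (X n)]

theorem sum_sq_norm_le_wk_sq {k : ℕ} (x : Fin k → lp X 2) {a : Fin k → 𝕜} (ha : ∀ i, ‖a i‖ ≤ 1)
    (s : Finset ℕ) : ∑ n ∈ s, ‖∑ i, a i • x i n‖ ^ 2 ≤ wk 𝕜 x ^ 2 := by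
  have h1 := sum_norm_sq_le_norm_sq (∑ i, a i • x i) s
  have h2 : ∀ n, (∑ i, a i • x i : lp X 2) n = ∑ i, a i • x i n := fun n => by
    rw [lp.coeFn_sum]; simp
  simp_rw [h2] at h1
  exact h1.trans (pow_le_pow_left₀ (norm_nonneg _) (norm_sum_smul_le_wk x ha) 2)

/-- The core estimate is real, so scalars are restricted to `ℝ` and the range of `T` is identified
with a real Euclidean space. The factor `2` is that of `wk_le_two_mul`. -/
theorem finite_sums_le_of_cotype {C : ℝ≥0} (hX : ∀ n, HasCotype2With C (X n))
    {T : lp X 2 →L[𝕜] Ell2 𝕜} (hT : IsFiniteRank T) (hfin : ∀ n, pi1 (restr T n) ≠ ∞)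
    (N k : ℕ) (x : Fin k → lp X 2) :
    ∑ i, ‖∑ n ∈ Finset.range N, restr T n (x i n)‖ ≤ 2 * cotypeConst C *
      Real.sqrt (∑ n ∈ Finset.range N, (pi1 (restr T n)).toReal ^ 2) * wk 𝕜 x := by
  let _ : ∀ n, NormedSpace ℝ (X n) := fun n => NormedSpace.restrictScalars ℝ 𝕜 (X n)
  have hsm : ∀ (r : ℝ) n (y : X n), r • y = (r : 𝕜) • y := fun r n y => rfl
  have : FiniteDimensional 𝕜 (LinearMap.range (T : lp X 2 →ₗ[𝕜] Ell2 𝕜)) := hT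
  obtain ⟨m, φ, hφn, hφs⟩ := exists_real_isometry (𝕜 := 𝕜)
    (LinearMap.range (T : lp X 2 →ₗ[𝕜] Ell2 𝕜))
  let t : ∀ n, X n →ₗ[𝕜] LinearMap.range (T : lp X 2 →ₗ[𝕜] Ell2 𝕜) := fun n =>
    (T : lp X 2 →ₗ[𝕜] Ell2 𝕜).rangeRestrict.comp
      (lp.singleContinuousLinearMap 𝕜 X 2 n : X n →ₗ[𝕜] lp X 2)
  have ht : ∀ n y, (t n y : Ell2 𝕜) = restr T n y := fun n y => rfl
  let U : ∀ n, X n →ₗ[ℝ] EuclideanSpace ℝ (Fin m) := fun n =>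
    { toFun := fun y => φ (t n y)
      map_add' := fun y z => by rw [map_add, map_add]
      map_smul' := fun r y => by rw [hsm, map_smul, hφs]; rfl }
  have hU : ∀ n y, U n y = φ (t n y) := fun n y => rfl
  have hUn : ∀ n y, ‖U n y‖ = ‖restr T n y‖ := fun n y => by
    rw [hU, hφn, ← ht, Submodule.coe_norm]
  have hsum : ∀ i, ‖∑ n : Fin N, U n (x i n)‖ = ‖∑ n ∈ Finset.range N, restr T n (x i n)‖ :=
    fun i => by
      simp_rw [hU]
      rw [← map_sum, hφn, Submodule.coe_norm, Submodule.coe_sum,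
        ← Fin.sum_univ_eq_sum_range fun n => restr T n (x i n)]
      rfl
  have hSS : ∀ n, SignSumming (2 * (pi1 (restr T n)).toReal) (U n) := fun n l y W hW => by
    simp_rw [hUn]
    refine (sum_norm_le_pi1 (hfin n) y).trans ?_
    rw [mul_comm (2 : ℝ), mul_assoc]
    gcongr
    exact wk_le_two_mul hW
  have key := sum_norm_le_of_cotype (X := fun n : Fin N => X n) (fun n => hX n)
    (fun n => U n) (fun n => 2 * (pi1 (restr T n)).toReal) (fun n => by positivity)
    (fun n => hSS n) (fun i n => x i n) (wk_nonneg (𝕜 := 𝕜) x) fun τ hτ => by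
      have := sum_sq_norm_le_wk_sq x (a := fun i => (τ i : 𝕜)) (by simpa using hτ)
        (Finset.range N)
      rw [← Fin.sum_univ_eq_sum_range fun n => ‖∑ i, (τ i : 𝕜) • x i n‖ ^ 2] at this
      exact this
  simp_rw [hsum] at key
  refine key.trans_eq ?_
  simp_rw [mul_pow, ← Finset.mul_sum]
  rw [Real.sqrt_mul (by norm_num), Real.sqrt_sq (by norm_num),
    ← Fin.sum_univ_eq_sum_range fun n => (pi1 (restr T n)).toReal ^ 2]
  ring

theorem exists_constant_of_cotype {C : ℝ≥0} (hX : ∀ n, HasCotype2With C (X n)) :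
    ∃ K : ℝ≥0, ∀ T : lp X 2 →L[𝕜] Ell2 𝕜, IsFiniteRank T →
      pi1 T ≤ K * (∑' n, pi1 (T.comp (sumProj 𝕜 X n)) ^ 2) ^ (1 / 2 : ℝ) := by
  refine ⟨max 1 (Real.toNNReal (2 * cotypeConst C)), fun T hT =>
    pi1_le_of_finite_sums (le_max_left _ _) fun hfin N k x =>
      (finite_sums_le_of_cotype hX hT hfin N k x).trans ?_⟩
  have := wk_nonneg (𝕜 := 𝕜) x
  gcongr
  rw [NNReal.coe_max]
  exact (Real.le_coe_toNNReal _).trans (le_max_right _ _)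

end CotypeCase

/-! ### Grothendieck's inequality over `𝕜`. -/

section Grothendieck

variable {𝕜 : Type*} [RCLike 𝕜]

/-- **Grothendieck's inequality** for vectors in a Hilbert space over `𝕜`. -/
theorem grothendieck_hilbert {H : Type*} [NormedAddCommGroup H] [InnerProductSpace 𝕜 H]
    {ι : Type*} [Fintype ι] {k : ℕ} (c : Fin k → ι → 𝕜) {W : ℝ}
    (hc : ∀ τ : ι → ℝ, (∀ s, |τ s| ≤ 1) → ∑ i, ‖∑ s, (τ s : 𝕜) * c i s‖ ≤ W)
    (b : ι → H) (hb : ∀ s, ‖b s‖ ≤ 1) :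
    ∑ i, ‖∑ s, c i s • b s‖ ≤ 46 * W := by
  have : FiniteDimensional 𝕜 (Submodule.span 𝕜 (Set.range b)) :=
    FiniteDimensional.span_of_finite 𝕜 (Set.finite_range b)
  obtain ⟨m, φ, hφn, hφs⟩ := exists_real_isometry (𝕜 := 𝕜) (Submodule.span 𝕜 (Set.range b))
  let b' : ι → Submodule.span 𝕜 (Set.range b) := fun s =>
    ⟨b s, Submodule.subset_span (Set.mem_range_self s)⟩
  -- Real coefficients are covered by the coordinate form with constant `23`; real and imaginary
  -- parts of `c` together give `46`.
  have hreal : ∀ d : Fin k → ι → ℝ,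
      (∀ τ : ι → ℝ, (∀ s, |τ s| ≤ 1) → ∑ i, |∑ s, τ s * d i s| ≤ W) →
      ∑ i, ‖∑ s, (d i s : 𝕜) • b s‖ ≤ 23 * W := fun d hd => by
    have h1 := grothendieck_coord d hd (fun s j => φ (b' s) j) fun s => by
      have h2 : ‖φ (b' s)‖ ^ 2 ≤ 1 := by
        rw [hφn]; exact pow_le_one₀ (norm_nonneg _) (hb s)
      rw [EuclideanSpace.norm_sq_eq] at h2
      simpa using h2
    refine le_trans (Finset.sum_le_sum fun i _ => le_of_eq ?_) h1
    have h3 : ∑ s, (d i s : 𝕜) • b s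
        = ((∑ s, (d i s : 𝕜) • b' s : Submodule.span 𝕜 (Set.range b)) : H) := by
      simp [b']
    rw [h3, ← Submodule.coe_norm, ← hφn, map_sum, EuclideanSpace.norm_eq]
    simp [hφs]
  have hre := hreal (fun i s => RCLike.re (c i s)) fun τ hτ =>
    (Finset.sum_le_sum fun i _ => by
      have := RCLike.abs_re_le_norm (∑ s, (τ s : 𝕜) * c i s)
      simpa [map_sum, RCLike.re_ofReal_mul] using this).trans (hc τ hτ)
  have him := hreal (fun i s => RCLike.im (c i s)) fun τ hτ =>
    (Finset.sum_le_sum fun i _ => by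
      have := RCLike.abs_im_le_norm (∑ s, (τ s : 𝕜) * c i s)
      simpa [map_sum, RCLike.im_ofReal_mul] using this).trans (hc τ hτ)
  have hI : ‖(RCLike.I : 𝕜)‖ ≤ 1 := by
    rcases eq_or_ne (RCLike.I : 𝕜) 0 with h | h
    · simp [h]
    · exact (RCLike.norm_I_of_ne_zero h).le
  calc ∑ i, ‖∑ s, c i s • b s‖
      ≤ ∑ i, (‖∑ s, ((RCLike.re (c i s) : ℝ) : 𝕜) • b s‖
          + ‖∑ s, ((RCLike.im (c i s) : ℝ) : 𝕜) • b s‖) := by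
        gcongr with i
        have : ∑ s, c i s • b s = ∑ s, ((RCLike.re (c i s) : ℝ) : 𝕜) • b s
            + (RCLike.I : 𝕜) • ∑ s, ((RCLike.im (c i s) : ℝ) : 𝕜) • b s := by
          rw [Finset.smul_sum, ← Finset.sum_add_distrib]
          refine Finset.sum_congr rfl fun s _ => ?_
          rw [smul_smul, ← add_smul, mul_comm, RCLike.re_add_im]
        rw [this]
        refine (norm_add_le _ _).trans ?_
        gcongr
        rw [norm_smul]
        exact mul_le_of_le_one_left (norm_nonneg _) hI
    _ ≤ 46 * W := by rw [Finset.sum_add_distrib]; linarith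

end Grothendieck

/-! ### Finite-dimensional `ℓ₁` inside `L₁(ν)`. -/

section L1

universe v

variable {𝕜 : Type*} [RCLike 𝕜] {Ω : Type*} [MeasurableSpace Ω] (ν : Measure Ω)

/-- Integration against a bounded measurable function. -/
theorem exists_dual_of_bounded {w : Ω → 𝕜} (hw : AEStronglyMeasurable w ν) (hw1 : ∀ ω, ‖w ω‖ ≤ 1) :
    ∃ ψ : StrongDual 𝕜 (Lp 𝕜 1 ν), ‖ψ‖ ≤ 1 ∧ ∀ f, ψ f = ∫ ω, w ω * f ω ∂ν := by
  have hint : ∀ f : Lp 𝕜 1 ν, Integrable (fun ω => w ω * f ω) ν := fun f =>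
    (L1.integrable_coeFn f).bdd_mul hw (Eventually.of_forall hw1)
  let ψ₀ : Lp 𝕜 1 ν →ₗ[𝕜] 𝕜 :=
    { toFun := fun f => ∫ ω, w ω * f ω ∂ν
      map_add' := fun f g => by
        rw [← integral_add (hint f) (hint g)]
        refine integral_congr_ae ?_
        filter_upwards [Lp.coeFn_add f g] with ω hω
        rw [hω, Pi.add_apply, mul_add]
      map_smul' := fun a f => by
        rw [RingHom.id_apply, ← integral_smul]
        refine integral_congr_ae ?_
        filter_upwards [Lp.coeFn_smul a f] with ω hω
        rw [hω, Pi.smul_apply, smul_eq_mul, smul_eq_mul]; ring }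
  refine ⟨ψ₀.mkContinuous 1 fun f => ?_, LinearMap.mkContinuous_norm_le _ zero_le_one _,
    fun f => rfl⟩
  rw [one_mul, L1.norm_eq_integral_norm]
  refine (norm_integral_le_integral_norm _).trans
    (integral_mono (hint f).norm (L1.integrable_coeFn f).norm fun ω => ?_)
  rw [norm_mul]
  exact mul_le_of_le_one_left (norm_nonneg _) (hw1 ω)

/-- Finitely many elements of `L₁(ν)` are approximated by combinations of a finite family which is
isometrically the unit vector basis of a finite-dimensional `ℓ₁`. -/
theorem exists_l1_approximation {𝕜 : Type v} [RCLike 𝕜] {Ω : Type*} [MeasurableSpace Ω]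
    (ν : Measure Ω) {k : ℕ} (f : Fin k → Lp 𝕜 1 ν) {δ : ℝ} (hδ : 0 < δ) :
    ∃ (ι : Type v) (_ : Fintype ι) (u : ι → Lp 𝕜 1 ν) (c : Fin k → ι → 𝕜), (∀ s, ‖u s‖ ≤ 1) ∧
      (∀ i, ‖f i - ∑ s, c i s • u s‖ ≤ δ) ∧
      ∀ τ : ι → ℝ, (∀ s, |τ s| ≤ 1) →
        ∃ ψ : StrongDual 𝕜 (Lp 𝕜 1 ν), ‖ψ‖ ≤ 1 ∧ ∀ s, ψ (u s) = τ s := by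
  classical
  -- All `k` functions are approximated at once by one simple function with values in `𝕜ᵏ`, so that
  -- they share the same level sets.
  let G : Ω → Fin k → 𝕜 := fun ω i => f i ω
  have hG : MemLp G 1 ν := MemLp.of_eval fun i => Lp.memLp (f i)
  obtain ⟨g, hg, hgm⟩ := hG.exists_simpleFunc_eLpNorm_sub_lt (by norm_num)
    (ε := ENNReal.ofReal δ) (by simpa using hδ)
  have hEm : ∀ v, MeasurableSet (g ⁻¹' {v}) := fun v => g.measurableSet_fiber v
  -- The level set of `0` may have infinite measure, and null level sets cannot be normalized;
  -- neither contributes to the approximation.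
  let s : Finset (Fin k → 𝕜) := g.range.filter fun v => v ≠ 0 ∧ ν (g ⁻¹' {v}) ≠ 0
  have hfin : ∀ v : s, ν (g ⁻¹' {(v : Fin k → 𝕜)}) ≠ ∞ := fun v =>
    (SimpleFunc.measure_preimage_lt_top_of_memLp (by norm_num) (by norm_num) g hgm v
      (Finset.mem_filter.1 v.2).2.1).ne
  have hpos : ∀ v : s, 0 < ν.real (g ⁻¹' {(v : Fin k → 𝕜)}) := fun v =>
    ENNReal.toReal_pos (Finset.mem_filter.1 v.2).2.2 (hfin v)
  let u : s → Lp 𝕜 1 ν := fun v => indicatorConstLp 1 (hEm v) (hfin v)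
    (((ν.real (g ⁻¹' {(v : Fin k → 𝕜)}))⁻¹ : ℝ) : 𝕜)
  let c : Fin k → s → 𝕜 := fun i v => (v : Fin k → 𝕜) i * (ν.real (g ⁻¹' {(v : Fin k → 𝕜)}) : 𝕜)
  have hu : ∀ v : s, u v =ᵐ[ν] (g ⁻¹' {(v : Fin k → 𝕜)}).indicator fun _ =>
      (((ν.real (g ⁻¹' {(v : Fin k → 𝕜)}))⁻¹ : ℝ) : 𝕜) := fun v => indicatorConstLp_coeFn
  have hnull : ∀ᵐ ω ∂ν, g ω ≠ 0 → g ω ∈ s := by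
    have : ∀ v ∈ g.range, ∀ᵐ ω ∂ν, g ω = v → v ≠ 0 → v ∈ s := fun v hv => by
      by_cases h0 : ν (g ⁻¹' {v}) = 0
      · filter_upwards [measure_eq_zero_iff_ae_notMem.1 h0] with ω hω h
        exact absurd h hω
      · exact Eventually.of_forall fun ω _ hv0 => Finset.mem_filter.2 ⟨hv, hv0, h0⟩
    filter_upwards [(ae_ball_iff g.range.countable_toSet).2 this] with ω hω h
    exact hω (g ω) (g.mem_range_self ω) rfl h
  refine ⟨s, inferInstance, u, c, fun v => ?_, fun i => ?_, fun τ hτ => ?_⟩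
  · simp only [u]
    rw [norm_indicatorConstLp (by norm_num) (by norm_num)]
    simp [abs_of_pos (hpos v), (hpos v).ne']
  · have hy : (∑ v, c i v • u v : Lp 𝕜 1 ν) =ᵐ[ν] fun ω => g ω i := by
      have h1 : ∀ v, (c i v • u v : Lp 𝕜 1 ν) =ᵐ[ν] fun ω =>
          c i v * (g ⁻¹' {(v : Fin k → 𝕜)}).indicator (fun _ =>
            (((ν.real (g ⁻¹' {(v : Fin k → 𝕜)}))⁻¹ : ℝ) : 𝕜)) ω := fun v => by
        filter_upwards [Lp.coeFn_smul (c i v) (u v), hu v] with ω h1 h2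
        rw [h1, Pi.smul_apply, h2, smul_eq_mul]
      filter_upwards [Lp.coeFn_finsetSum Finset.univ fun v => c i v • u v,
        ae_all_iff.2 h1, hnull] with ω hω h1 h2
      rw [hω, Finset.sum_apply]
      simp_rw [h1]
      by_cases h0 : g ω = 0
      · rw [Finset.sum_eq_zero fun v _ => ?_, h0]; · rfl
        rw [Set.indicator_of_notMem, mul_zero]
        intro hv
        have hv' : g ω = v := hv
        exact (Finset.mem_filter.1 v.2).2.1 (by rw [← hv', h0])
      · have hmem := h2 h0
        rw [Finset.sum_eq_single (⟨g ω, hmem⟩ : s)]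
        · rw [Set.indicator_of_mem (by simp)]
          have := (hpos ⟨g ω, hmem⟩).ne'
          simp only [c]
          rw [mul_assoc, ← RCLike.ofReal_mul, mul_inv_cancel₀ this]; simp
        · intro v _ hv
          rw [Set.indicator_of_notMem, mul_zero]
          intro hv'
          exact hv (Subtype.ext (show g ω = v from hv').symm)
        · simp
    rw [Lp.norm_def]
    refine ENNReal.toReal_le_of_le_ofReal hδ.le ((eLpNorm_mono_ae ?_).trans hg.le)
    filter_upwards [hy, Lp.coeFn_sub (f i) (∑ v, c i v • u v)] with ω h1 h2
    rw [h2, Pi.sub_apply, h1]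
    exact norm_le_pi_norm ((G - ⇑g) ω) i
  · let t : (Fin k → 𝕜) → 𝕜 := fun v => if h : v ∈ s then (τ ⟨v, h⟩ : 𝕜) else 0
    obtain ⟨ψ, hψ1, hψ⟩ := exists_dual_of_bounded ν (w := g.map t)
      (g.map t).stronglyMeasurable.aestronglyMeasurable fun ω => by
        rw [SimpleFunc.map_apply]
        simp only [t]
        split_ifs with h
        · simpa using hτ _
        · simp
    refine ⟨ψ, hψ1, fun v => ?_⟩
    rw [hψ]
    have : (fun ω => (g.map t) ω * u v ω) =ᵐ[ν] (g ⁻¹' {(v : Fin k → 𝕜)}).indicator fun _ =>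
        (τ v : 𝕜) * (((ν.real (g ⁻¹' {(v : Fin k → 𝕜)}))⁻¹ : ℝ) : 𝕜) := by
      filter_upwards [hu v] with ω hω
      rw [hω]
      by_cases h : ω ∈ g ⁻¹' {(v : Fin k → 𝕜)}
      · have h' : g ω = v := h
        rw [Set.indicator_of_mem h, Set.indicator_of_mem h, SimpleFunc.map_apply, h']
        simp [t]
      · rw [Set.indicator_of_notMem h, Set.indicator_of_notMem h, mul_zero]
    rw [integral_congr_ae this, integral_indicator (hEm v), setIntegral_const,
      RCLike.real_smul_eq_coe_mul, mul_left_comm, ← RCLike.ofReal_mul,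
      mul_inv_cancel₀ (hpos v).ne']
    simp

end L1

/-! ### The case of the Gordon-Lewis property. -/

section GordonLewisCase

variable {𝕜 : Type*} [RCLike 𝕜]

theorem norm_sum_dual_le {X : ℕ → Type*} [∀ n, NormedAddCommGroup (X n)] [∀ n, NormedSpace 𝕜 (X n)]
    {N : ℕ} (F : ∀ n : Fin N, StrongDual 𝕜 (X n)) :
    ‖∑ n : Fin N, (F n).comp (lp.evalCLM 𝕜 X 2 (n : ℕ))‖ ≤ Real.sqrt (∑ n, ‖F n‖ ^ 2) := by
  refine ContinuousLinearMap.opNorm_le_bound _ (Real.sqrt_nonneg _) fun y => ?_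
  have h1 : (∑ n : Fin N, (F n).comp (lp.evalCLM 𝕜 X 2 (n : ℕ))) y = ∑ n : Fin N, F n (y n) := by
    rw [sum_apply]; rfl
  rw [h1]
  calc ‖∑ n : Fin N, F n (y n)‖ ≤ ∑ n : Fin N, ‖F n‖ * ‖y n‖ :=
        (norm_sum_le _ _).trans (Finset.sum_le_sum fun n _ => (F n).le_opNorm _)
    _ ≤ Real.sqrt (∑ n, ‖F n‖ ^ 2) * Real.sqrt (∑ n : Fin N, ‖y n‖ ^ 2) :=
        Real.sum_mul_le_sqrt_mul_sqrt _ _ _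
    _ ≤ Real.sqrt (∑ n, ‖F n‖ ^ 2) * ‖y‖ := by
        gcongr
        rw [Fin.sum_univ_eq_sum_range fun n => ‖y n‖ ^ 2]
        exact Real.sqrt_le_iff.2 ⟨norm_nonneg _, sum_norm_sq_le_norm_sq y _⟩

variable {X : ℕ → Type*} [∀ n, NormedAddCommGroup (X n)] [∀ n, NormedSpace 𝕜 (X n)]
  {H : Type*} [NormedAddCommGroup H] [InnerProductSpace 𝕜 H]

/-- Operators which factor through `L₁`-spaces on the summands of an `ℓ₂`-sum. -/
theorem sum_norm_le_of_factorization {N : ℕ} {Ω : Fin N → Type*} [∀ n, MeasurableSpace (Ω n)]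
    (ν : ∀ n, Measure (Ω n)) (A : ∀ n : Fin N, X n →L[𝕜] Lp 𝕜 1 (ν n))
    (B : ∀ n : Fin N, Lp 𝕜 1 (ν n) →L[𝕜] H) {k : ℕ} (x : Fin k → lp X 2) :
    ∑ i, ‖∑ n : Fin N, B n (A n (x i n))‖
      ≤ 46 * Real.sqrt (∑ n, (‖A n‖ * ‖B n‖) ^ 2) * wk 𝕜 x := by
  set Q := Real.sqrt (∑ n, (‖A n‖ * ‖B n‖) ^ 2) with hQ
  have key : ∀ δ : ℝ, 0 < δ → ∑ i, ‖∑ n : Fin N, B n (A n (x i n))‖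
      ≤ 46 * Q * wk 𝕜 x + (47 * (k * ∑ n, ‖B n‖)) * δ := fun δ hδ => by
    choose ι hι u c hu hc hψ using fun n : Fin N =>
      exists_l1_approximation (ν n) (fun i => A n (x i n)) hδ
    let y : ∀ n : Fin N, Fin k → Lp 𝕜 1 (ν n) := fun n i => ∑ s, c n i s • u n s
    have herr : ∀ i n, ‖A n (x i n) - y n i‖ ≤ δ := fun i n => hc n i
    -- All the `ℓ₁`-bases are joined into one family. Moving `‖B‖` from the vectors to the
    -- coefficients puts the vectors in the unit ball, as Grothendieck's inequality asks.
    let b : (Σ n, ι n) → H := fun z => ((‖B z.1‖⁻¹ : ℝ) : 𝕜) • B z.1 (u z.1 z.2)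
    let d : Fin k → (Σ n, ι n) → 𝕜 := fun i z => (‖B z.1‖ : 𝕜) * c z.1 i z.2
    have hb : ∀ z, ‖b z‖ ≤ 1 := fun z => by
      simp only [b]
      rw [norm_smul, RCLike.norm_ofReal, abs_of_nonneg (by positivity)]
      refine inv_mul_le_one_of_le₀ ?_ (norm_nonneg _)
      exact ((B z.1).le_opNorm _).trans (mul_le_of_le_one_right (norm_nonneg _) (hu _ _))
    have hdb : ∀ i, ∑ z, d i z • b z = ∑ n, B n (y n i) := fun i => by
      rw [Fintype.sum_sigma]
      refine Finset.sum_congr rfl fun n _ => ?_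
      simp only [d, b, y, map_sum, map_smul, smul_smul]
      refine Finset.sum_congr rfl fun s _ => ?_
      rcases eq_or_ne ‖B n‖ 0 with h0 | h0
      · have : B n = 0 := norm_eq_zero.1 h0
        simp [this]
      · rw [mul_right_comm, ← RCLike.ofReal_mul, mul_inv_cancel₀ h0]; simp
    have hS : ∀ i, ∑ n, ‖B n‖ * ‖A n (x i n) - y n i‖ ≤ (∑ n, ‖B n‖) * δ := fun i => by
      rw [Finset.sum_mul]
      gcongr with n
      exact herr i n
    have hW : ∀ τ : (Σ n, ι n) → ℝ, (∀ z, |τ z| ≤ 1) →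
        ∑ i, ‖∑ z, (τ z : 𝕜) * d i z‖ ≤ Q * wk 𝕜 x + k * ((∑ n, ‖B n‖) * δ) := fun τ hτ => by
      choose ψ hψ1 hψu using fun n => hψ n (fun s => τ ⟨n, s⟩) fun s => hτ _
      -- The signs `τ` on the `ℓ₁`-basis extend to `ψ n` on `L₁`. Pulled back by `A n`, they give
      -- one functional on the `ℓ₂`-sum which reproduces the scalar sums up to the approximation
      -- error.
      let F : ∀ n : Fin N, StrongDual 𝕜 (X n) := fun n => (‖B n‖ : 𝕜) • (ψ n).comp (A n)
      have hF : ∀ n, ‖F n‖ ≤ ‖A n‖ * ‖B n‖ := fun n => by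
        simp only [F]
        rw [norm_smul, RCLike.norm_ofReal, abs_norm, mul_comm]
        gcongr
        exact ((ψ n).opNorm_comp_le _).trans (mul_le_of_le_one_left (norm_nonneg _) (hψ1 n))
      let Φ : StrongDual 𝕜 (lp X 2) := ∑ n : Fin N, (F n).comp (lp.evalCLM 𝕜 X 2 (n : ℕ))
      have hΦ : ∀ z, Φ z = ∑ n : Fin N, F n (z n) := fun z => by
        simp only [Φ]; rw [sum_apply]; rfl
      have hΦn : ‖Φ‖ ≤ Q := (norm_sum_dual_le F).trans
        (Real.sqrt_le_sqrt (Finset.sum_le_sum fun n _ =>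
          pow_le_pow_left₀ (norm_nonneg _) (hF n) 2))
      have hval : ∀ i, ∑ z, (τ z : 𝕜) * d i z
          = Φ (x i) - ∑ n, (‖B n‖ : 𝕜) * ψ n (A n (x i n) - y n i) := fun i => by
        rw [hΦ, ← Finset.sum_sub_distrib, Fintype.sum_sigma]
        refine Finset.sum_congr rfl fun n _ => ?_
        simp only [F, smul_apply, ContinuousLinearMap.comp_apply, smul_eq_mul]
        rw [map_sub, mul_sub, sub_sub_cancel]
        simp only [y, map_sum, map_smul, hψu, Finset.mul_sum, d, smul_eq_mul]
        exact Finset.sum_congr rfl fun s _ => by ring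
      calc ∑ i, ‖∑ z, (τ z : 𝕜) * d i z‖ ≤ ∑ i, (‖Φ (x i)‖ + (∑ n, ‖B n‖) * δ) := by
            gcongr with i
            rw [hval]
            refine (norm_sub_le _ _).trans ?_
            gcongr
            refine (norm_sum_le _ _).trans (le_trans (Finset.sum_le_sum fun n _ => ?_) (hS i))
            rw [norm_mul, RCLike.norm_ofReal, abs_norm]
            gcongr
            exact ((ψ n).le_opNorm _).trans (mul_le_of_le_one_left (norm_nonneg _) (hψ1 n))
        _ = ∑ i, ‖Φ (x i)‖ + k * ((∑ n, ‖B n‖) * δ) := by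
            rw [Finset.sum_add_distrib]; simp
        _ ≤ Q * wk 𝕜 x + k * ((∑ n, ‖B n‖) * δ) := by
            gcongr
            refine (sum_norm_le_norm_mul_wk x Φ).trans ?_
            have := wk_nonneg (𝕜 := 𝕜) x
            gcongr
    have hG := grothendieck_hilbert d hW b hb
    simp_rw [hdb] at hG
    calc ∑ i, ‖∑ n : Fin N, B n (A n (x i n))‖
        ≤ ∑ i, (‖∑ n, B n (y n i)‖ + (∑ n, ‖B n‖) * δ) := by
          gcongr with i
          have : ∑ n : Fin N, B n (A n (x i n))
              = ∑ n, B n (y n i) + ∑ n, B n (A n (x i n) - y n i) := by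
            rw [← Finset.sum_add_distrib]
            exact Finset.sum_congr rfl fun n _ => by rw [map_sub, add_sub_cancel]
          rw [this]
          refine (norm_add_le _ _).trans ?_
          gcongr
          exact (norm_sum_le _ _).trans
            ((Finset.sum_le_sum fun n _ => (B n).le_opNorm _).trans (hS i))
      _ = ∑ i, ‖∑ n, B n (y n i)‖ + k * ((∑ n, ‖B n‖) * δ) := by
          rw [Finset.sum_add_distrib]; simp
      _ ≤ 46 * (Q * wk 𝕜 x + k * ((∑ n, ‖B n‖) * δ)) + k * ((∑ n, ‖B n‖) * δ) := by gcongr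
      _ = _ := by ring
  have hlim : Tendsto (fun δ : ℝ => 46 * Q * wk 𝕜 x + (47 * (k * ∑ n, ‖B n‖)) * δ) (𝓝[>] 0)
      (𝓝 (46 * Q * wk 𝕜 x)) := by
    have : Tendsto (fun δ : ℝ => 46 * Q * wk 𝕜 x + (47 * (k * ∑ n, ‖B n‖)) * δ) (𝓝 0)
        (𝓝 (46 * Q * wk 𝕜 x + (47 * (k * ∑ n, ‖B n‖)) * 0)) :=
      Continuous.tendsto (by fun_prop) 0
    rw [mul_zero, add_zero] at this
    exact this.mono_left nhdsWithin_le_nhds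
  exact ge_of_tendsto hlim (by filter_upwards [self_mem_nhdsWithin] with δ hδ using key δ hδ)

theorem IsFiniteRank.restr {T : lp X 2 →L[𝕜] Ell2 𝕜} (hT : IsFiniteRank T) (n : ℕ) :
    IsFiniteRank (restr T n) := by
  have : FiniteDimensional 𝕜 (LinearMap.range (T : lp X 2 →ₗ[𝕜] Ell2 𝕜)) := hT
  refine Submodule.finiteDimensional_of_le
    (S₂ := LinearMap.range (T : lp X 2 →ₗ[𝕜] Ell2 𝕜)) ?_
  rintro _ ⟨y, rfl⟩
  exact ⟨lp.single 2 n y, rfl⟩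

/-- The slack `δ` is there because the infimum defining `gamma1` need not be attained. -/
theorem HasGL2With.exists_factorization {𝕜 : Type*} [RCLike 𝕜] {E : Type u} [NormedAddCommGroup E]
    [NormedSpace 𝕜 E] {C : ℝ≥0} (hE : HasGL2With 𝕜 C E)
    {T : E →L[𝕜] Ell2 𝕜} (hT : IsFiniteRank T) (hfin : pi1 T ≠ ∞) {δ : ℝ} (hδ : 0 < δ) :
    ∃ (Ω : Type u) (_ : MeasurableSpace Ω) (ν : Measure Ω) (A : E →L[𝕜] Lp 𝕜 1 ν)
      (B : Lp 𝕜 1 ν →L[𝕜] Ell2 𝕜), T = B.comp A ∧ ‖A‖ * ‖B‖ ≤ C * (pi1 T).toReal + δ := by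
  have hne : (C : ℝ≥0∞) * pi1 T ≠ ∞ := ENNReal.mul_ne_top ENNReal.coe_ne_top hfin
  have h1 : gamma1 T < C * pi1 T + ENNReal.ofReal δ :=
    (hE T hT).trans_lt (ENNReal.lt_add_right hne (by simpa using hδ))
  simp only [gamma1, iInf_lt_iff] at h1
  obtain ⟨Ω, m, ν, A, B, hAB, h⟩ := h1
  refine ⟨Ω, m, ν, A, B, hAB, ?_⟩
  have h2 := ENNReal.toReal_mono (by finiteness) h.le
  rw [ENNReal.toReal_add hne ENNReal.ofReal_ne_top, ENNReal.toReal_ofReal hδ.le] at h2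
  simpa using h2

theorem finite_sums_le_of_gl2 {C : ℝ≥0} (hX : ∀ n, HasGL2With 𝕜 C (X n))
    {T : lp X 2 →L[𝕜] Ell2 𝕜} (hT : IsFiniteRank T) (hfin : ∀ n, pi1 (restr T n) ≠ ∞)
    (N k : ℕ) (x : Fin k → lp X 2) :
    ∑ i, ‖∑ n ∈ Finset.range N, restr T n (x i n)‖ ≤ 46 * C *
      Real.sqrt (∑ n ∈ Finset.range N, (pi1 (restr T n)).toReal ^ 2) * wk 𝕜 x := by
  have key : ∀ δ : ℝ, 0 < δ → ∑ i, ‖∑ n ∈ Finset.range N, restr T n (x i n)‖ ≤ 46 *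
      Real.sqrt (∑ n ∈ Finset.range N, (C * (pi1 (restr T n)).toReal + δ) ^ 2) * wk 𝕜 x :=
    fun δ hδ => by
      choose Ω m ν A B hAB hle using fun n : Fin N =>
        (hX n).exists_factorization (hT.restr n) (hfin n) hδ
      have h1 := sum_norm_le_of_factorization ν A B x
      have h2 : ∀ i, ∑ n : Fin N, B n (A n (x i n))
          = ∑ n ∈ Finset.range N, restr T n (x i n) := fun i => by
        rw [← Fin.sum_univ_eq_sum_range fun n => restr T n (x i n)]
        exact Finset.sum_congr rfl fun n _ => by rw [hAB n]; rfl
      simp_rw [h2] at h1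
      refine h1.trans ?_
      have := wk_nonneg (𝕜 := 𝕜) x
      rw [← Fin.sum_univ_eq_sum_range fun n => (C * (pi1 (restr T n)).toReal + δ) ^ 2]
      gcongr with n
      exact hle n
  have hlim : Tendsto (fun δ : ℝ => 46 *
      Real.sqrt (∑ n ∈ Finset.range N, (C * (pi1 (restr T n)).toReal + δ) ^ 2) * wk 𝕜 x) (𝓝[>] 0)
      (𝓝 (46 * Real.sqrt (∑ n ∈ Finset.range N, (C * (pi1 (restr T n)).toReal + 0) ^ 2)
        * wk 𝕜 x)) :=
    (Continuous.tendsto (by fun_prop) 0).mono_left nhdsWithin_le_nhds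
  refine (ge_of_tendsto hlim
    (by filter_upwards [self_mem_nhdsWithin] with δ hδ using key δ hδ)).trans_eq ?_
  simp_rw [add_zero, mul_pow, ← Finset.mul_sum]
  rw [Real.sqrt_mul (by positivity), Real.sqrt_sq (NNReal.coe_nonneg C)]
  ring

theorem exists_constant_of_gl2 {C : ℝ≥0} (hX : ∀ n, HasGL2With 𝕜 C (X n)) :
    ∃ K : ℝ≥0, ∀ T : lp X 2 →L[𝕜] Ell2 𝕜, IsFiniteRank T →
      pi1 T ≤ K * (∑' n, pi1 (T.comp (sumProj 𝕜 X n)) ^ 2) ^ (1 / 2 : ℝ) := by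
  refine ⟨max 1 (46 * C), fun T hT =>
    pi1_le_of_finite_sums (le_max_left _ _) fun hfin N k x =>
      (finite_sums_le_of_gl2 hX hT hfin N k x).trans ?_⟩
  have := wk_nonneg (𝕜 := 𝕜) x
  gcongr
  rw [NNReal.coe_max]
  exact le_max_right _ _

end GordonLewisCase

/-! ### Scalar Gaussian sums. -/

section GaussSeq

instance : IsProbabilityMeasure gaussSeq := by unfold gaussSeq; infer_instance

theorem memLp_coord (j : ℕ) : MemLp (fun ω : ℕ → ℝ => ω j) 2 gaussSeq :=
  (memLp_id_gaussianReal (μ := 0) (v := 1) 2).comp_measurePreserving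
    (measurePreserving_eval_infinitePi (fun _ : ℕ => gaussianReal 0 1) j)

/-- Rotation invariance: the sum is a linear functional of finitely many coordinates, whose joint
law is standard Gaussian, so only the Euclidean norm of `a` enters. -/
theorem gaussSeq_map_sum (m : ℕ) (a : ℕ → ℝ) :
    gaussSeq.map (fun ω => ∑ j ∈ Finset.range m, ω j * a j) =
      (gaussianReal 0 1).map (Real.sqrt (∑ j ∈ Finset.range m, a j ^ 2) * ·) := by
  let I := Finset.range m
  let v : EuclideanSpace ℝ I := WithLp.toLp 2 fun j => a j
  have hv : ‖v‖ = Real.sqrt (∑ j ∈ Finset.range m, a j ^ 2) := by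
    rw [EuclideanSpace.norm_eq, ← Finset.sum_coe_sort (Finset.range m) fun j => a j ^ 2]
    simp only [v, Real.norm_eq_abs, sq_abs]
    rfl
  have h1 : (fun ω : ℕ → ℝ => ∑ j ∈ Finset.range m, ω j * a j)
      = (innerSL ℝ v) ∘ (WithLp.toLp 2) ∘ I.restrict := by
    ext ω
    simp only [Function.comp_apply, innerSL_apply_apply, PiLp.inner_apply, v]
    rw [← Finset.sum_coe_sort]
    simp [I]
  have h2 : (stdGaussian (EuclideanSpace ℝ I)).map (innerSL ℝ v)
      = gaussianReal 0 (‖v‖ ^ 2).toNNReal := by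
    rw [IsGaussian.map_eq_gaussianReal, integral_strongDual_stdGaussian, variance_dual_stdGaussian]
    simp
  rw [h1, ← Measure.map_map (by fun_prop) (by fun_prop), ← Measure.map_map (by fun_prop)
    (by fun_prop), gaussSeq, Measure.infinitePi_map_restrict, map_pi_eq_stdGaussian, h2, ← hv,
    gaussianReal_map_const_mul]
  congr 1
  · simp
  · ext; simp

/-- The first absolute moment of the standard normal law. -/
def gaussAbs : ℝ := ∫ z, |z| ∂(gaussianReal 0 1)

theorem gaussAbs_pos : 0 < gaussAbs := by
  have hint : Integrable (fun z : ℝ => |z|) (gaussianReal 0 1) :=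
    ((memLp_id_gaussianReal (μ := 0) (v := 1) 1).integrable (by norm_num)).abs
  refine (integral_nonneg fun z => abs_nonneg z).lt_of_ne fun h => ?_
  have h1 := (integral_eq_zero_iff_of_nonneg (fun z => abs_nonneg z) hint).1 h.symm
  have h2 : (fun z : ℝ => z) =ᵐ[gaussianReal 0 1] 0 := by
    filter_upwards [h1] with z hz using abs_eq_zero.1 hz
  have h3 := variance_fun_id_gaussianReal (μ := 0) (v := 1)
  rw [variance_congr h2] at h3
  simp at h3

theorem integral_abs_sum (m : ℕ) (a : ℕ → ℝ) :
    ∫ ω, |∑ j ∈ Finset.range m, ω j * a j| ∂gaussSeq =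
      Real.sqrt (∑ j ∈ Finset.range m, a j ^ 2) * gaussAbs := by
  have hm : Measurable (fun ω : ℕ → ℝ => ∑ j ∈ Finset.range m, ω j * a j) := by fun_prop
  have h1 : ∫ z, |z| ∂(gaussSeq.map (fun ω => ∑ j ∈ Finset.range m, ω j * a j))
      = ∫ ω, |∑ j ∈ Finset.range m, ω j * a j| ∂gaussSeq :=
    integral_map hm.aemeasurable (by fun_prop)
  rw [← h1, gaussSeq_map_sum, integral_map (by fun_prop) (by fun_prop)]
  simp_rw [abs_mul, abs_of_nonneg (Real.sqrt_nonneg _)]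
  rw [integral_const_mul, gaussAbs]

variable {𝕜 : Type*} [RCLike 𝕜] {E : Type*} [NormedAddCommGroup E] [NormedSpace 𝕜 E]

theorem memLp_gauss_sum (m : ℕ) (f : ℕ → E) :
    MemLp (fun ω : ℕ → ℝ => ∑ j ∈ Finset.range m, (ω j : 𝕜) • f j) 2 gaussSeq := by
  refine memLp_finsetSum _ fun j _ => ?_
  have h1 : MemLp (fun ω : ℕ → ℝ => (ω j : 𝕜)) 2 gaussSeq := (memLp_coord j).ofReal
  refine MemLp.of_le_mul (c := ‖f j‖) h1 (h1.1.smul_const (f j))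
    (Eventually.of_forall fun ω => ?_)
  rw [norm_smul, mul_comm]

/-- For real coefficients the first moment is exactly `gaussAbs` times the Euclidean norm; real and
imaginary parts are treated separately, whence the `2`. -/
theorem sqrt_sum_norm_sq_le (m : ℕ) (a : ℕ → 𝕜) :
    Real.sqrt (∑ j ∈ Finset.range m, ‖a j‖ ^ 2) ≤
      2 * gaussAbs⁻¹ * ∫ ω, ‖∑ j ∈ Finset.range m, (ω j : 𝕜) * a j‖ ∂gaussSeq := by
  have hint : Integrable (fun ω : ℕ → ℝ => ‖∑ j ∈ Finset.range m, (ω j : 𝕜) * a j‖) gaussSeq :=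
    ((memLp_gauss_sum (𝕜 := 𝕜) m a).integrable (by norm_num)).norm
  have hintR : ∀ b : ℕ → ℝ, Integrable (fun ω : ℕ → ℝ => |∑ j ∈ Finset.range m, ω j * b j|)
      gaussSeq := fun b => by
    simpa using ((memLp_gauss_sum (𝕜 := ℝ) m b).integrable (by norm_num)).abs
  have hre := integral_abs_sum m fun j => RCLike.re (a j)
  have him := integral_abs_sum m fun j => RCLike.im (a j)
  have hre' : ∫ ω, |∑ j ∈ Finset.range m, ω j * RCLike.re (a j)| ∂gaussSeq
      ≤ ∫ ω, ‖∑ j ∈ Finset.range m, (ω j : 𝕜) * a j‖ ∂gaussSeq :=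
    integral_mono (hintR _) hint fun ω => by
      have := RCLike.abs_re_le_norm (∑ j ∈ Finset.range m, (ω j : 𝕜) * a j)
      simpa [map_sum, RCLike.re_ofReal_mul] using this
  have him' : ∫ ω, |∑ j ∈ Finset.range m, ω j * RCLike.im (a j)| ∂gaussSeq
      ≤ ∫ ω, ‖∑ j ∈ Finset.range m, (ω j : 𝕜) * a j‖ ∂gaussSeq :=
    integral_mono (hintR _) hint fun ω => by
      have := RCLike.abs_im_le_norm (∑ j ∈ Finset.range m, (ω j : 𝕜) * a j)
      simpa [map_sum, RCLike.im_ofReal_mul] using this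
  rw [hre] at hre'
  rw [him] at him'
  have hsplit : Real.sqrt (∑ j ∈ Finset.range m, ‖a j‖ ^ 2) ≤
      Real.sqrt (∑ j ∈ Finset.range m, RCLike.re (a j) ^ 2)
        + Real.sqrt (∑ j ∈ Finset.range m, RCLike.im (a j) ^ 2) := by
    have : ∑ j ∈ Finset.range m, ‖a j‖ ^ 2 = ∑ j ∈ Finset.range m, RCLike.re (a j) ^ 2
        + ∑ j ∈ Finset.range m, RCLike.im (a j) ^ 2 := by
      rw [← Finset.sum_add_distrib]
      exact Finset.sum_congr rfl fun j _ => by rw [RCLike.norm_sq_eq_def, sq, sq]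
    rw [this]
    exact Real.sqrt_le_iff.2 ⟨by positivity, by
      rw [add_sq, Real.sq_sqrt (by positivity), Real.sq_sqrt (by positivity)]
      have : 0 ≤ 2 * Real.sqrt (∑ j ∈ Finset.range m, RCLike.re (a j) ^ 2)
        * Real.sqrt (∑ j ∈ Finset.range m, RCLike.im (a j) ^ 2) := by positivity
      linarith⟩
  rw [← le_div_iff₀ gaussAbs_pos] at hre' him'
  refine hsplit.trans ((add_le_add hre' him').trans_eq ?_)
  rw [div_eq_mul_inv]; ring

end GaussSeq

/-! ### Summing estimates on the bidual. -/

section LocalReflexivity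

variable {𝕜 : Type*} [RCLike 𝕜] {E : Type*} [NormedAddCommGroup E] [NormedSpace 𝕜 E]

/-- The dual of an `ℓ_∞`-sum is an `ℓ₁`-sum: almost norming vectors, rotated to make all values
nonnegative, form a single vector of sup norm at most one. -/
theorem sum_norm_comp_single_le {κ : Type*} [Fintype κ] [DecidableEq κ]
    (g : StrongDual 𝕜 (κ → E)) :
    ∑ e, ‖g.comp (ContinuousLinearMap.single 𝕜 (fun _ : κ => E) e)‖ ≤ ‖g‖ := by
  refine le_of_forall_pos_le_add fun δ hδ => ?_
  set r : ℝ := δ / (Fintype.card κ + 1) with hr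
  have hr0 : 0 < r := by positivity
  have h1 : ∀ e, ∃ y : E, ‖y‖ ≤ 1 ∧
      ‖g.comp (ContinuousLinearMap.single 𝕜 (fun _ : κ => E) e)‖ - r ≤ ‖g (Pi.single e y)‖ ∧
      g (Pi.single e y) = (‖g (Pi.single e y)‖ : 𝕜) := fun e => by
    obtain ⟨y, hy, hgy⟩ := ContinuousLinearMap.exists_lt_apply_of_lt_opNorm
      (g.comp (ContinuousLinearMap.single 𝕜 (fun _ : κ => E) e)) (sub_lt_self _ hr0)
    have hgy' : ‖g.comp (ContinuousLinearMap.single 𝕜 (fun _ : κ => E) e)‖ - r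
        < ‖g (Pi.single e y)‖ := hgy
    obtain ⟨z, hz1, hz⟩ := RCLike.exists_norm_eq_mul_self (g (Pi.single e y))
    have h2 : g (Pi.single e (z • y)) = (‖g (Pi.single e y)‖ : 𝕜) := by
      rw [hz]
      exact map_smul (g.comp (ContinuousLinearMap.single 𝕜 (fun _ : κ => E) e)) z y
    refine ⟨z • y, by rw [norm_smul, hz1, one_mul]; exact hy.le, ?_, ?_⟩
    · rw [h2]; simpa using hgy'.le
    · rw [h2]; simp
  choose y hy1 hyg hyn using h1
  have h3 : ‖g y‖ ≤ ‖g‖ := (g.le_opNorm y).trans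
    (mul_le_of_le_one_right (norm_nonneg _) ((pi_norm_le_iff_of_nonneg zero_le_one).2 hy1))
  have h4 : g y = ((∑ e, ‖g (Pi.single e (y e))‖ : ℝ) : 𝕜) := by
    conv_lhs => rw [← Finset.univ_sum_single y, map_sum]
    rw [RCLike.ofReal_sum]
    exact Finset.sum_congr rfl fun e _ => hyn e
  rw [h4, RCLike.norm_ofReal, abs_of_nonneg (by positivity)] at h3
  calc _ ≤ ∑ e, (‖g (Pi.single e (y e))‖ + r) := Finset.sum_le_sum fun e _ => by
        linarith [hyg e]
    _ = ∑ e, ‖g (Pi.single e (y e))‖ + Fintype.card κ * r := by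
        rw [Finset.sum_add_distrib]; simp
    _ ≤ ‖g‖ + δ := by
        gcongr
        rw [hr, mul_div_assoc', div_le_iff₀ (by positivity)]
        nlinarith

/-- A family of functionals which is bounded with respect to the weak `ℓ₁`-norm on the space has
the same bound on the bidual. -/
theorem norm_sum_bidual_le {k : ℕ} (f : Fin k → StrongDual 𝕜 E) {p : ℝ} (hp : 0 ≤ p)
    (hf : ∀ (x : Fin k → E) (W : ℝ), (∀ e : Fin k → ℤˣ, ‖∑ i, (sgnR (e i) : 𝕜) • x i‖ ≤ W) →
      ‖∑ i, f i (x i)‖ ≤ p * W)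
    (ξ : Fin k → StrongDual 𝕜 (StrongDual 𝕜 E)) {W : ℝ} (hW : 0 ≤ W)
    (hξ : ∀ e : Fin k → ℤˣ, ‖∑ i, (sgnR (e i) : 𝕜) • ξ i‖ ≤ W) :
    ‖∑ i, ξ i (f i)‖ ≤ p * W := by
  classical
  -- `D` lists all signed sums, so the hypothesis says that `x ↦ ∑ fᵢ(xᵢ)` has norm at most `p` on
  -- its range in the sup norm.
  let D : (Fin k → E) →ₗ[𝕜] ((Fin k → ℤˣ) → E) := LinearMap.pi fun e =>
    ∑ i, (sgnR (e i) : 𝕜) • LinearMap.proj i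
  have hD : ∀ x e, D x e = ∑ i, (sgnR (e i) : 𝕜) • x i := fun x e => by
    simp [D, LinearMap.sum_apply]
  -- A continuous left inverse of `D`, by orthogonality of the coordinates of `e`; it turns that
  -- functional into a continuous one before Hahn-Banach is applied.
  let α : Fin k → ((Fin k → ℤˣ) → E) →L[𝕜] E := fun i =>
    ((2 ^ k : 𝕜)⁻¹) • ∑ e : Fin k → ℤˣ, (sgnR (e i) : 𝕜) • ContinuousLinearMap.proj e
  have hα : ∀ x i, α i (D x) = x i := fun x i => by
    have h1 : ∀ j, ∑ e : Fin k → ℤˣ, sgnR (e i) * sgnR (e j) = if j = i then 2 ^ k else 0 :=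
      fun j => by
        split_ifs with h
        · subst h
          simp_rw [← sq, sgnR_sq]
          simp
        · exact sum_sgn_mul_eq_zero i (fun e => sgnR (e j)) fun e => by rw [flipSign_ne h]
    have h2 : α i (D x) = (2 ^ k : 𝕜)⁻¹ • ∑ j, ((∑ e : Fin k → ℤˣ, sgnR (e i) * sgnR (e j) : ℝ) : 𝕜)
        • x j := by
      simp only [α, smul_apply, sum_apply, ContinuousLinearMap.proj_apply, hD]
      congr 1
      simp_rw [Finset.smul_sum, smul_smul]
      rw [Finset.sum_comm]
      refine Finset.sum_congr rfl fun j _ => ?_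
      rw [← Finset.sum_smul]
      push_cast
      rfl
    rw [h2]
    simp_rw [h1]
    rw [Finset.sum_eq_single i (fun j _ hj => by simp [hj]) (by simp)]
    rw [if_pos rfl, RCLike.ofReal_pow, RCLike.ofReal_ofNat, inv_smul_smul₀ (by simp)]
  let Λ : StrongDual 𝕜 ((Fin k → ℤˣ) → E) := ∑ i, (f i).comp (α i)
  have hΛ : ∀ x, Λ (D x) = ∑ i, f i (x i) := fun x => by
    simp only [Λ, sum_apply, ContinuousLinearMap.comp_apply, hα]
  have hΛn : ‖Λ.comp (LinearMap.range D).subtypeL‖ ≤ p := by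
    refine ContinuousLinearMap.opNorm_le_bound _ hp ?_
    rintro ⟨_, x, rfl⟩
    change ‖Λ (D x)‖ ≤ p * ‖D x‖
    rw [hΛ]
    exact hf x _ fun e => by rw [← hD]; exact norm_le_pi_norm (D x) e
  obtain ⟨g, hg, hgn⟩ := exists_extension_norm_eq (LinearMap.range D)
    (Λ.comp (LinearMap.range D).subtypeL)
  let γ : (Fin k → ℤˣ) → StrongDual 𝕜 E := fun e =>
    g.comp (ContinuousLinearMap.single 𝕜 (fun _ : Fin k → ℤˣ => E) e)
  have hγ : ∑ e, ‖γ e‖ ≤ p := (sum_norm_comp_single_le g).trans (hgn.le.trans hΛn)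
  -- The extension splits as a family `γ e` of total norm at most `p`. This identity in the dual
  -- lets any bidual elements be inserted, and `ξ` then enters only through its signed sums.
  have hfγ : ∀ i, f i = ∑ e, (sgnR (e i) : 𝕜) • γ e := fun i => by
    ext x
    have h1 : g (D (Pi.single i x)) = f i x := by
      have := hg ⟨D (Pi.single i x), LinearMap.mem_range_self D _⟩
      refine this.trans ((hΛ _).trans ?_)
      rw [Finset.sum_eq_single i (fun j _ hj => by simp [hj]) (by simp)]
      simp
    have h2 : D (Pi.single i x) = ∑ e, Pi.single e ((sgnR (e i) : 𝕜) • x) := by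
      rw [← Finset.univ_sum_single (D (Pi.single i x))]
      refine Finset.sum_congr rfl fun e _ => ?_
      rw [hD, Finset.sum_eq_single i (fun j _ hj => by simp [hj]) (by simp)]
      simp
    rw [← h1, h2, map_sum, sum_apply]
    refine Finset.sum_congr rfl fun e _ => ?_
    rw [Pi.single_smul, map_smul, smul_apply]
    rfl
  calc ‖∑ i, ξ i (f i)‖ = ‖∑ e, (∑ i, (sgnR (e i) : 𝕜) • ξ i) (γ e)‖ := by
        congr 1
        simp_rw [hfγ, map_sum, map_smul, sum_apply, smul_apply]
        rw [Finset.sum_comm]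
    _ ≤ ∑ e, W * ‖γ e‖ := (norm_sum_le _ _).trans (Finset.sum_le_sum fun e _ =>
        (ContinuousLinearMap.le_opNorm _ _).trans (by gcongr; exact hξ e))
    _ ≤ p * W := by rw [← Finset.mul_sum, mul_comm]; gcongr

end LocalReflexivity

/-! ### The case of the Gaussian average property. -/

section GaussianAverageCase

variable {𝕜 : Type*} [RCLike 𝕜] {E : Type*} [NormedAddCommGroup E] [NormedSpace 𝕜 E]

/-- The operator on `ℓ₂` which maps the first `m` unit vectors to given vectors and vanishes on
the others. -/
def synth (m : ℕ) (f : ℕ → E) : Ell2 𝕜 →L[𝕜] E :=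
  ∑ j ∈ Finset.range m, (lp.evalCLM 𝕜 (fun _ : ℕ => 𝕜) 2 j).smulRight (f j)

theorem synth_apply (m : ℕ) (f : ℕ → E) (y : Ell2 𝕜) :
    synth m f y = ∑ j ∈ Finset.range m, y j • f j := by
  rw [synth, sum_apply]; rfl

theorem synth_unitVec (m : ℕ) (f : ℕ → E) (i : ℕ) :
    synth m f (unitVec 𝕜 i) = if i < m then f i else 0 := by
  rw [synth_apply, unitVec]
  split_ifs with h
  · rw [Finset.sum_eq_single i]
    · rw [lp.single_apply_self, one_smul]
    · intro j _ hj
      rw [lp.single_apply_ne _ _ _ hj, zero_smul]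
    · exact fun h' => absurd (Finset.mem_range.2 h) h'
  · refine Finset.sum_eq_zero fun j hj => ?_
    have : j ≠ i := fun h' => h (h' ▸ Finset.mem_range.1 hj)
    rw [lp.single_apply_ne _ _ _ this, zero_smul]

theorem isFiniteRank_synth (m : ℕ) (f : ℕ → E) : IsFiniteRank (synth (𝕜 := 𝕜) m f) := by
  have : FiniteDimensional 𝕜 (Submodule.span 𝕜 (f '' (Finset.range m : Set ℕ))) :=
    FiniteDimensional.span_of_finite 𝕜 ((Finset.finite_toSet _).image f)
  refine Submodule.finiteDimensional_of_le
    (S₂ := Submodule.span 𝕜 (f '' (Finset.range m : Set ℕ))) ?_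
  rintro _ ⟨y, rfl⟩
  change synth m f y ∈ _
  rw [synth_apply]
  exact Submodule.sum_mem _ fun j hj => Submodule.smul_mem _ _
    (Submodule.subset_span (Set.mem_image_of_mem f hj))

theorem gaussPartialSum_synth {m n : ℕ} (hn : m ≤ n) (f : ℕ → E) :
    gaussPartialSum (synth (𝕜 := 𝕜) m f) n = fun ω => ∑ j ∈ Finset.range m, (ω j : 𝕜) • f j := by
  ext ω
  rw [gaussPartialSum]
  simp_rw [synth_unitVec]
  rw [← Finset.sum_subset (Finset.range_mono hn)]
  · exact Finset.sum_congr rfl fun j hj => by rw [if_pos (Finset.mem_range.1 hj)]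
  · intro j _ hj
    rw [if_neg (fun h => hj (Finset.mem_range.2 h)), smul_zero]

/-- The partial sums are constant from `m` on, so every admissible limit agrees with the finite sum
almost everywhere. -/
theorem eLpNorm_le_ellNorm_synth (m : ℕ) (f : ℕ → E) :
    eLpNorm (fun ω : ℕ → ℝ => ∑ j ∈ Finset.range m, (ω j : 𝕜) • f j) 2 gaussSeq
      ≤ ellNorm (synth (𝕜 := 𝕜) m f) := by
  set G := fun ω : ℕ → ℝ => ∑ j ∈ Finset.range m, (ω j : 𝕜) • f j with hG
  refine le_iInf fun h => le_iInf fun hh => le_iInf fun hlim => ?_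
  have hconst : Tendsto (fun n => eLpNorm (gaussPartialSum (synth (𝕜 := 𝕜) m f) n - h) 2 gaussSeq)
      atTop (𝓝 (eLpNorm (G - h) 2 gaussSeq)) := by
    refine tendsto_const_nhds.congr' ?_
    filter_upwards [eventually_ge_atTop m] with n hn
    rw [gaussPartialSum_synth hn]
  have h0 := tendsto_nhds_unique hconst hlim
  rw [eLpNorm_eq_zero_iff ((memLp_gauss_sum m f).1.sub hh.1) (by norm_num)] at h0
  refine (eLpNorm_congr_ae ?_).le
  filter_upwards [h0] with ω hω
  exact sub_eq_zero.1 hω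

theorem norm_sum_mul_le (s : Finset ℕ) (a b : ℕ → 𝕜) :
    ‖∑ j ∈ s, a j * b j‖ ≤ Real.sqrt (∑ j ∈ s, ‖a j‖ ^ 2) * Real.sqrt (∑ j ∈ s, ‖b j‖ ^ 2) :=
  (norm_sum_le _ _).trans (by simp_rw [norm_mul]; exact Real.sum_mul_le_sqrt_mul_sqrt _ _ _)

/-- Passage to the adjoint: if `‖T x‖² = ∑ |fⱼ(x)|²`, then `y ↦ ∑ yⱼ fⱼ` is an adjoint of `T`, and
the 1-summing norm of its adjoint is controlled by that of `T`. -/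
theorem pi1_dualOp_synth_le {F : Type*} [NormedAddCommGroup F] [NormedSpace 𝕜 F] (T : E →L[𝕜] F)
    (hT : pi1 T ≠ ∞) (m : ℕ) (f : ℕ → StrongDual 𝕜 E)
    (hf : ∀ x, ‖T x‖ = Real.sqrt (∑ j ∈ Finset.range m, ‖f j x‖ ^ 2)) :
    pi1 (dualOp (synth (𝕜 := 𝕜) m f)) ≤ ENNReal.ofReal (2 * (pi1 T).toReal) := by
  refine pi1_le (by positivity) fun k ξ => ?_
  let r : Fin k → ℝ := fun i => Real.sqrt (∑ j ∈ Finset.range m, ‖ξ i (f j)‖ ^ 2)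
  have hr : ∀ i, r i ^ 2 = ∑ j ∈ Finset.range m, ‖ξ i (f j)‖ ^ 2 := fun i =>
    Real.sq_sqrt (by positivity)
  have hnorm : ∀ i, ‖dualOp (synth (𝕜 := 𝕜) m f) (ξ i)‖ ≤ r i := fun i => by
    refine ContinuousLinearMap.opNorm_le_bound _ (Real.sqrt_nonneg _) fun y => ?_
    have h1 : dualOp (synth (𝕜 := 𝕜) m f) (ξ i) y = ∑ j ∈ Finset.range m, y j * ξ i (f j) := by
      change ξ i (synth m f y) = _
      rw [synth_apply, map_sum]
      exact Finset.sum_congr rfl fun j _ => by rw [map_smul, smul_eq_mul]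
    rw [h1, mul_comm]
    refine (norm_sum_mul_le _ _ _).trans ?_
    gcongr
    exact Real.sqrt_le_iff.2 ⟨norm_nonneg _, sum_norm_sq_le_norm_sq y _⟩
  -- Coefficients attaining the Euclidean norm `r i` of the vector `ξ i (f j)`, or zero if that
  -- vector vanishes. The functionals `g i` then satisfy `|g i x| ≤ ‖T x‖`, so the summing estimate
  -- for `T` is one for the `g i` and passes to the bidual.
  let a : Fin k → ℕ → 𝕜 := fun i j => ((r i)⁻¹ : ℝ) * (starRingEnd 𝕜) (ξ i (f j))
  have ha : ∀ i, Real.sqrt (∑ j ∈ Finset.range m, ‖a i j‖ ^ 2) ≤ 1 := fun i => by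
    refine Real.sqrt_le_one.2 ?_
    simp only [a, norm_mul, RCLike.norm_conj, RCLike.norm_ofReal, mul_pow, sq_abs,
      ← Finset.mul_sum, ← hr]
    rw [← mul_pow]
    exact pow_le_one₀ (mul_nonneg (inv_nonneg.2 (Real.sqrt_nonneg _)) (Real.sqrt_nonneg _))
      inv_mul_le_one
  let g : Fin k → StrongDual 𝕜 E := fun i => ∑ j ∈ Finset.range m, a i j • f j
  have hg : ∀ i x, ‖g i x‖ ≤ ‖T x‖ := fun i x => by
    have : g i x = ∑ j ∈ Finset.range m, a i j * f j x := by
      simp only [g, sum_apply, smul_apply, smul_eq_mul]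
    rw [this, hf]
    refine (norm_sum_mul_le _ _ _).trans ?_
    exact mul_le_of_le_one_left (Real.sqrt_nonneg _) (ha i)
  have hξg : ∀ i, ξ i (g i) = (r i : 𝕜) := fun i => by
    have h1 : ξ i (g i) = ((r i)⁻¹ : ℝ) * ((r i ^ 2 : ℝ) : 𝕜) := by
      rw [hr, RCLike.ofReal_sum, Finset.mul_sum]
      simp only [g, map_sum, map_smul, smul_eq_mul, a]
      refine Finset.sum_congr rfl fun j _ => ?_
      rw [mul_assoc, RCLike.conj_mul, RCLike.ofReal_pow]
    rw [h1, ← RCLike.ofReal_mul]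
    congr 1
    rcases eq_or_ne (r i) 0 with h0 | h0
    · simp [h0]
    · field_simp
  have key := norm_sum_bidual_le g (p := 2 * (pi1 T).toReal) (by positivity)
    (fun x W hW => by
      calc ‖∑ i, g i (x i)‖ ≤ ∑ i, ‖T (x i)‖ :=
            (norm_sum_le _ _).trans (Finset.sum_le_sum fun i _ => hg i _)
        _ ≤ (pi1 T).toReal * wk 𝕜 x := sum_norm_le_pi1 hT x
        _ ≤ (pi1 T).toReal * (2 * W) := by gcongr; exact wk_le_two_mul hW
        _ = 2 * (pi1 T).toReal * W := by ring) ξ (wk_nonneg (𝕜 := 𝕜) ξ)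
    fun e => norm_sum_smul_le_wk ξ fun i => by
      rw [RCLike.norm_ofReal, abs_sgnR]
  simp_rw [hξg, ← RCLike.ofReal_sum] at key
  rw [RCLike.norm_ofReal] at key
  exact (Finset.sum_le_sum fun i _ => hnorm i).trans ((le_abs_self _).trans key)

/-- In a space with the Gaussian average property the average of a finite Gaussian sum is controlled
by the 1-summing norm. -/
theorem HasGAPWith.integral_norm_sq_le {C : ℝ≥0} (hE : HasGAPWith 𝕜 C (StrongDual 𝕜 E))
    {F : Type*} [NormedAddCommGroup F] [NormedSpace 𝕜 F] (T : E →L[𝕜] F)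
    (hT : pi1 T ≠ ∞) (m : ℕ) (f : ℕ → StrongDual 𝕜 E)
    (hf : ∀ x, ‖T x‖ = Real.sqrt (∑ j ∈ Finset.range m, ‖f j x‖ ^ 2)) :
    ∫ ω, ‖∑ j ∈ Finset.range m, (ω j : 𝕜) • f j‖ ^ 2 ∂gaussSeq ≤ (2 * C * (pi1 T).toReal) ^ 2 := by
  have h1 : eLpNorm (fun ω : ℕ → ℝ => ∑ j ∈ Finset.range m, (ω j : 𝕜) • f j) 2 gaussSeq
      ≤ ENNReal.ofReal (2 * C * (pi1 T).toReal) := by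
    refine (eLpNorm_le_ellNorm_synth m f).trans ((hE _ (isFiniteRank_synth m f)).trans ?_)
    rw [mul_comm (2 : ℝ), mul_assoc, ENNReal.ofReal_mul (NNReal.coe_nonneg C), ENNReal.ofReal_coe_nnreal]
    gcongr
    exact pi1_dualOp_synth_le T hT m f hf
  have hm : MemLp (fun ω : ℕ → ℝ => ∑ j ∈ Finset.range m, (ω j : 𝕜) • f j) 2 gaussSeq :=
    memLp_gauss_sum m f
  have hI : 0 ≤ ∫ ω, ‖∑ j ∈ Finset.range m, (ω j : 𝕜) • f j‖ ^ 2 ∂gaussSeq :=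
    integral_nonneg fun _ => by positivity
  rw [hm.eLpNorm_eq_integral_rpow_norm (by norm_num) (by norm_num),
    ENNReal.ofReal_le_ofReal_iff (by positivity)] at h1
  norm_num at h1
  rw [← Real.sqrt_eq_rpow] at h1
  exact (Real.sqrt_le_left (by positivity)).1 h1

variable {X : ℕ → Type*} [∀ n, NormedAddCommGroup (X n)] [∀ n, NormedSpace 𝕜 (X n)]

theorem exists_coordinates {T : E →L[𝕜] Ell2 𝕜} (hT : IsFiniteRank T) :
    ∃ (m : ℕ) (f : ℕ → StrongDual 𝕜 E),
      ∀ x, ‖T x‖ = Real.sqrt (∑ j ∈ Finset.range m, ‖f j x‖ ^ 2) := by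
  have : FiniteDimensional 𝕜 (LinearMap.range (T : E →ₗ[𝕜] Ell2 𝕜)) := hT
  let b := stdOrthonormalBasis 𝕜 (LinearMap.range (T : E →ₗ[𝕜] Ell2 𝕜))
  let d := Module.finrank 𝕜 (LinearMap.range (T : E →ₗ[𝕜] Ell2 𝕜))
  refine ⟨d, fun j => if h : j < d then (innerSL 𝕜 (b ⟨j, h⟩ : Ell2 𝕜)).comp T else 0,
    fun x => ?_⟩
  rw [← Fin.sum_univ_eq_sum_range (fun j => ‖(if h : j < d then
    (innerSL 𝕜 (b ⟨j, h⟩ : Ell2 𝕜)).comp T else 0 : StrongDual 𝕜 E) x‖ ^ 2)]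
  have h1 := b.sum_sq_norm_inner_right ⟨T x, LinearMap.mem_range_self _ x⟩
  simp only [Fin.is_lt, dite_true, ContinuousLinearMap.comp_apply, innerSL_apply_apply, Fin.eta]
  simp only [Submodule.coe_inner, Submodule.coe_norm] at h1
  rw [h1, Real.sqrt_sq (norm_nonneg _)]

theorem integral_sqrt_le {Ω : Type*} [MeasurableSpace Ω] {μ : Measure Ω} [IsProbabilityMeasure μ]
    {q : Ω → ℝ} (hq : Integrable q μ) (hq0 : ∀ ω, 0 ≤ q ω) :
    ∫ ω, Real.sqrt (q ω) ∂μ ≤ Real.sqrt (∫ ω, q ω ∂μ) := by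
  have hs : MemLp (fun ω => Real.sqrt (q ω)) 2 μ := by
    rw [memLp_two_iff_integrable_sq (Real.continuous_sqrt.comp_aestronglyMeasurable hq.1)]
    simpa [Real.sq_sqrt (hq0 _)] using hq
  have h1 := variance_nonneg (fun ω => Real.sqrt (q ω)) μ
  rw [variance_eq_sub hs] at h1
  -- Nonnegativity of the variance of `√q` is the inequality needed.
  refine Real.le_sqrt_of_sq_le ?_
  have h2 : ∫ ω, ((fun ω => Real.sqrt (q ω)) ^ 2) ω ∂μ = ∫ ω, q ω ∂μ :=
    integral_congr_ae (Eventually.of_forall fun ω => Real.sq_sqrt (hq0 ω))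
  rw [h2] at h1
  linarith

/-- The constant is the product of `2 * gaussAbs⁻¹`, from comparing a Euclidean norm with a first
Gaussian moment, and `2 * C`, from GAP and the passage to the bidual. -/
theorem finite_sums_le_of_gap {C : ℝ≥0} (hX : ∀ n, HasGAPWith 𝕜 C (StrongDual 𝕜 (X n)))
    {T : lp X 2 →L[𝕜] Ell2 𝕜} (hT : IsFiniteRank T) (hfin : ∀ n, pi1 (restr T n) ≠ ∞)
    (N k : ℕ) (x : Fin k → lp X 2) :
    ∑ i, ‖∑ n ∈ Finset.range N, restr T n (x i n)‖ ≤ 4 * gaussAbs⁻¹ * C *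
      Real.sqrt (∑ n ∈ Finset.range N, (pi1 (restr T n)).toReal ^ 2) * wk 𝕜 x := by
  obtain ⟨m, f, hf⟩ := exists_coordinates hT
  have hfr : ∀ n y, ‖restr T n y‖
      = Real.sqrt (∑ j ∈ Finset.range m, ‖restr (f j) n y‖ ^ 2) := fun n y => by
    simp only [restr_apply]; exact hf _
  let g : ∀ n, (ℕ → ℝ) → StrongDual 𝕜 (X n) := fun n ω =>
    ∑ j ∈ Finset.range m, (ω j : 𝕜) • restr (f j) n
  have hgm : ∀ n, MemLp (g n) 2 gaussSeq := fun n => memLp_gauss_sum m fun j => restr (f j) n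
  have hgi : ∀ n, Integrable (fun ω => ‖g n ω‖ ^ 2) gaussSeq := fun n =>
    (hgm n).integrable_norm_pow (by norm_num)
  have hgap : ∀ n, ∫ ω, ‖g n ω‖ ^ 2 ∂gaussSeq ≤ (2 * C * (pi1 (restr T n)).toReal) ^ 2 := fun n =>
    (hX n).integral_norm_sq_le (restr T n) (hfin n) m (fun j => restr (f j) n) (hfr n)
  -- The same Gaussian variables are used on all summands, so that `Φ ω (x i)` is a Gaussian sum
  -- whose coefficients are the coordinates of the truncated `T (x i)`.
  let Φ : (ℕ → ℝ) → StrongDual 𝕜 (lp X 2) := fun ω =>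
    ∑ n : Fin N, (g n ω).comp (lp.evalCLM 𝕜 X 2 (n : ℕ))
  have hΦn : ∀ ω, ‖Φ ω‖ ≤ Real.sqrt (∑ n ∈ Finset.range N, ‖g n ω‖ ^ 2) := fun ω => by
    rw [← Fin.sum_univ_eq_sum_range fun n => ‖g n ω‖ ^ 2]
    exact norm_sum_dual_le fun n : Fin N => g n ω
  let c : Fin k → ℕ → 𝕜 := fun i j => ∑ n ∈ Finset.range N, restr (f j) n (x i n)
  have hΦ : ∀ ω i, Φ ω (x i) = ∑ j ∈ Finset.range m, (ω j : 𝕜) * c i j := fun ω i => by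
    have h1 : Φ ω (x i) = ∑ n ∈ Finset.range N, g n ω (x i n) := by
      rw [← Fin.sum_univ_eq_sum_range fun n => g n ω (x i n)]
      simp only [Φ]; rw [sum_apply]; rfl
    rw [h1]
    simp only [g, sum_apply, smul_apply, smul_eq_mul, c, Finset.mul_sum]
    rw [Finset.sum_comm]
  have hTc : ∀ i, ‖∑ n ∈ Finset.range N, restr T n (x i n)‖
      = Real.sqrt (∑ j ∈ Finset.range m, ‖c i j‖ ^ 2) := fun i => by
    have h1 : ∑ n ∈ Finset.range N, restr T n (x i n)
        = T (∑ n ∈ Finset.range N, lp.single 2 n (x i n)) := by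
      rw [map_sum]; rfl
    rw [h1, hf]
    simp only [map_sum, c, restr_apply]
  have hΦi : ∀ i, Integrable (fun ω => ‖Φ ω (x i)‖) gaussSeq := fun i => by
    simp_rw [hΦ]
    exact ((memLp_gauss_sum (𝕜 := 𝕜) m (c i)).integrable (by norm_num)).norm
  have hqi : Integrable (fun ω => ∑ n ∈ Finset.range N, ‖g n ω‖ ^ 2) gaussSeq :=
    integrable_finsetSum _ fun n _ => hgi n
  have hsqi : Integrable (fun ω => Real.sqrt (∑ n ∈ Finset.range N, ‖g n ω‖ ^ 2)) gaussSeq := by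
    refine MemLp.integrable (q := 2) (by norm_num) ?_
    rw [memLp_two_iff_integrable_sq (Real.continuous_sqrt.comp_aestronglyMeasurable hqi.1)]
    refine hqi.congr (Eventually.of_forall fun ω => ?_)
    exact (Real.sq_sqrt (by positivity)).symm
  have hw := wk_nonneg (𝕜 := 𝕜) x
  have hκ := gaussAbs_pos
  calc ∑ i, ‖∑ n ∈ Finset.range N, restr T n (x i n)‖
      ≤ ∑ i, 2 * gaussAbs⁻¹ * ∫ ω, ‖Φ ω (x i)‖ ∂gaussSeq := by
        gcongr with i
        rw [hTc]
        simp_rw [hΦ]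
        exact sqrt_sum_norm_sq_le m (c i)
    _ = 2 * gaussAbs⁻¹ * ∫ ω, ∑ i, ‖Φ ω (x i)‖ ∂gaussSeq := by
        rw [← Finset.mul_sum, integral_finsetSum _ fun i _ => hΦi i]
    _ ≤ 2 * gaussAbs⁻¹ * ∫ ω, Real.sqrt (∑ n ∈ Finset.range N, ‖g n ω‖ ^ 2) * wk 𝕜 x
          ∂gaussSeq := by
        refine mul_le_mul_of_nonneg_left (integral_mono
          (integrable_finsetSum _ fun i _ => hΦi i) (hsqi.mul_const _) fun ω => ?_) (by positivity)
        exact (sum_norm_le_norm_mul_wk x (Φ ω)).trans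
          (mul_le_mul_of_nonneg_right (hΦn ω) hw)
    _ ≤ 2 * gaussAbs⁻¹ * (Real.sqrt (∑ n ∈ Finset.range N,
          (2 * C * (pi1 (restr T n)).toReal) ^ 2) * wk 𝕜 x) := by
        rw [integral_mul_const]
        gcongr
        refine (integral_sqrt_le hqi fun ω => by positivity).trans (Real.sqrt_le_sqrt ?_)
        rw [integral_finsetSum _ fun n _ => hgi n]
        exact Finset.sum_le_sum fun n _ => hgap n
    _ = _ := by
        simp_rw [mul_pow _ (ENNReal.toReal _), ← Finset.mul_sum]
        rw [Real.sqrt_mul (by positivity), Real.sqrt_sq (by positivity)]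
        ring

theorem exists_constant_of_gap {C : ℝ≥0} (hX : ∀ n, HasGAPWith 𝕜 C (StrongDual 𝕜 (X n))) :
    ∃ K : ℝ≥0, ∀ T : lp X 2 →L[𝕜] Ell2 𝕜, IsFiniteRank T →
      pi1 T ≤ K * (∑' n, pi1 (T.comp (sumProj 𝕜 X n)) ^ 2) ^ (1 / 2 : ℝ) := by
  refine ⟨max 1 (Real.toNNReal (4 * gaussAbs⁻¹ * C)), fun T hT =>
    pi1_le_of_finite_sums (le_max_left _ _) fun hfin N k x =>
      (finite_sums_le_of_gap hX hT hfin N k x).trans ?_⟩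
  have := wk_nonneg (𝕜 := 𝕜) x
  gcongr
  rw [NNReal.coe_max]
  exact (Real.le_coe_toNNReal _).trans (le_max_right _ _)

end GaussianAverageCase

end GaussianAverage

end

theorem theorem1p22 {𝕜 : Type*} [RCLike 𝕜] (X : ℕ → Type*)
    [∀ n, NormedAddCommGroup (X n)] [∀ n, NormedSpace 𝕜 (X n)] [∀ n, CompleteSpace (X n)]
    (h : (∃ C : ℝ≥0, ∀ n, GaussianAverage.HasGAPWith 𝕜 C (StrongDual 𝕜 (X n))) ∨
      (∃ C : ℝ≥0, ∀ n, GaussianAverage.HasGL2With 𝕜 C (X n)) ∨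
      (∃ C : ℝ≥0, ∀ n, GaussianAverage.HasCotype2With C (X n))) :
    ∃ K : ℝ≥0, ∀ T : lp X 2 →L[𝕜] GaussianAverage.Ell2 𝕜, GaussianAverage.IsFiniteRank T →
      GaussianAverage.pi1 T ≤
        K * (∑' n, GaussianAverage.pi1 (T.comp (GaussianAverage.sumProj 𝕜 X n)) ^ 2) ^ (1 / 2 : ℝ) := by
  rcases h with ⟨C, hC⟩ | ⟨C, hC⟩ | ⟨C, hC⟩
  · exact GaussianAverage.exists_constant_of_gap hC
  · exact GaussianAverage.exists_constant_of_gl2 hC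
  · exact GaussianAverage.exists_constant_of_cotype hC
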